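/- Let $n \ge 2$ be an integer and let $G$ be a finite group. A $G$-prepartition of $[n]=\{1,\dots,n\}$ is a partition $\mu$ of $\{0,1,\dots,n\}$ together with a labeling $\varphi$, with values in $G$, of the elements that do not lie in the block containing $0$ (the zero block). Put $(\mu,\varphi)\ge(\mu',\varphi')$ if every nonzero block of $\mu$ is a union of nonzero blocks of $\mu'$ and the labelings coincide on the nonzero blocks of $\mu$. Two $G$-prepartitions $(\mu,\varphi)$, $(\mu',\varphi')$ are equivalent if $\mu=\mu'$ and for every nonzero block $B$ of $\mu$ there is $g\in G$ with $\varphi|_B=g\cdot\varphi'|_B$. The Dowling geometry $Q_n(G)$ is the set of equivalence classes with the induced order; it is a finite graded bounded poset. For a finite simplicial complex $\Delta$ of dimension $d-1$ with $f_i$ faces of cardinality $i$, the $h$-polynomial is $h(\Delta;y)=\sum_{i=0}^{d} f_i\,y^i(1-y)^{d-i}$. For a finite graded bounded poset $P$ with rank function $\mathrm{rk}$ and M\"obius function $\mu$, and $s<t$ in $P$, put $\overline{\chi}_{s,t}(x)=\frac{1}{x-1}\sum_{s\le w\le t}\mu(s,w)\,x^{\mathrm{rk}(t)-\mathrm{rk}(w)}$;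 define $\underline{H}_{t,t}=1$ and $\underline{H}_{s,t}=\sum_{s<w\le t}\overline{\chi}_{s,w}\,\underline{H}_{w,t}$ for $s<t$. The Chow polynomial of $P$ is $\underline{H}_P=\underline{H}_{\hat0,\hat1}$ and the augmented Chow polynomial is $H_P=\sum_{s\in P}x^{\mathrm{rk}(s)}\,\underline{H}_{s,\hat1}$. Then all complex zeros of each of the following polynomials are real: the $h$-polynomial of the order complex of $Q_n(G)$ (both for the complex of all chains of $Q_n(G)$ and for the complex of all chains of the proper part $Q_n(G)\setminus\{\hat0,\hat1\}$), the Chow polynomial of $Q_n(G)$, and the augmented Chow polynomial of $Q_n(G)$. This includes the braid matroids of type A and B: if $|G|=1$, then $Q_n(G)$ is isomorphic, as a poset, to the intersection lattice (all intersections of hyperplanes, including the empty intersection, ordered by reverse inclusion) of the type A braid arrangement $\{x_i=x_j\}_{1\le i<j\le n+1}$ in $\mathbb{C}^{n+1}$; if $|G|=2$, then $Q_n(G)$ is isomorphic to the intersection lattice of the type B braid arrangement $\{x_i=x_j\},\ \{x_i=-x_j\}\ (1\le i<j\le n),\ \{x_k=0\}\ (1\le k\le n)$ in $\mathbb{C}^n$.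 -/

import Mathlib

open Polynomial

/-! ## Face enumeration on simplicial complexes -/

/-- The faces of a finite simplicial complex, including the empty face (Mathlib's complexes only
record the nonempty faces). -/
noncomputable def faceFinset {V : Type*} [Finite V] (K : AbstractSimplicialComplex V) :
    Finset (Finset V) :=
  (Set.toFinite (insert ∅ K.faces)).toFinset

/-- `f_i(K)`: the number of faces of `K` of cardinality `i`. -/
noncomputable def fNumber {V : Type*} [Finite V] (K : AbstractSimplicialComplex V) (i : ℕ) : ℕ :=
  ((faceFinset K).filter (fun σ => σ.card = i)).card

/-- The number `d = dim K + 1`: the largest cardinality of a face of `K`. -/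
noncomputable def maxFaceCard {V : Type*} [Finite V] (K : AbstractSimplicialComplex V) : ℕ :=
  (faceFinset K).sup Finset.card

/-- The `h`-polynomial `h(K; y) = (1 - y)^d f(K; y / (1 - y)) = ∑ i ≤ d, f_i y^i (1 - y)^(d - i)`
of a complex of dimension `d - 1`. -/
noncomputable def hPolynomial {V : Type*} [Finite V] (K : AbstractSimplicialComplex V) : ℤ[X] :=
  ∑ i ∈ Finset.range (maxFaceCard K + 1),
    C (fNumber K i : ℤ) * X ^ i * (1 - X) ^ (maxFaceCard K - i)

/-- The order complex of a poset: the vertices are the elements of the poset and the faces are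
the (nonempty) finite chains. -/
def orderComplex (P : Type*) [PartialOrder P] : AbstractSimplicialComplex P where
  faces := {σ | σ.Nonempty ∧ IsChain (· ≤ ·) (σ : Set P)}
  isRelLowerSet_faces := fun _ hσ =>
    ⟨hσ.1, fun _ hτ hne => ⟨hne, hσ.2.mono (Finset.coe_subset.mpr hτ)⟩⟩
  singleton_mem v := ⟨Finset.singleton_nonempty v, by simp⟩

/-! ## Chow polynomials of finite graded bounded posets -/

section Chow

/-- The rank of an element of a finite graded bounded poset: the maximal length of a chain that
ends at the element. -/
noncomputable def posetRank {P : Type*} [PartialOrder P] (s : P) : ℕ := (Order.height s).toNat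

/-- The characteristic polynomial `χ_{s,t}(x) = ∑_{s ≤ w ≤ t} μ(s, w) x^(rk t - rk w)` of the
interval `[s, t]`. -/
noncomputable def intervalCharPoly {P : Type*} [PartialOrder P] [LocallyFiniteOrder P]
    [DecidableEq P] (s t : P) : ℤ[X] :=
  ∑ w ∈ Finset.Icc s t, C (IncidenceAlgebra.mu ℤ s w) * X ^ (posetRank t - posetRank w)

/-- The reduced characteristic polynomial `χ_{s,t}(x) / (x - 1)` of an interval `[s, t]` with
`s < t`. -/
noncomputable def reducedCharPoly {P : Type*} [PartialOrder P] [LocallyFiniteOrder P]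
    [DecidableEq P] (s t : P) : ℤ[X] :=
  intervalCharPoly s t /ₘ (X - C 1)

/-- The division in the definition of the reduced characteristic polynomial is exact. -/
theorem mul_reducedCharPoly {P : Type*} [PartialOrder P] [LocallyFiniteOrder P]
    [DecidableEq P] {s t : P} (h : s < t) :
    (X - C 1) * reducedCharPoly s t = intervalCharPoly s t := by
  rw [reducedCharPoly, mul_divByMonic_eq_iff_isRoot, IsRoot, intervalCharPoly, eval_finsetSum]
  simpa [h.ne] using IncidenceAlgebra.sum_Icc_mu_right (𝕜 := ℤ) s t

/-- The Chow polynomial of the interval `[s, t]`, defined by the recursion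
`H_{s,t} = ∑_{s < w ≤ t} χ̄_{s,w} H_{w,t}` with `H_{t,t} = 1`. -/
noncomputable def intervalChowPoly {P : Type*} [PartialOrder P] [LocallyFiniteOrder P]
    [DecidableEq P] (s t : P) : ℤ[X] :=
  if s = t then 1
  else ∑ w ∈ (Finset.Ioc s t).attach, reducedCharPoly s w.1 * intervalChowPoly w.1 t
termination_by (Finset.Icc s t).card
decreasing_by
  have h := Finset.mem_Ioc.1 w.2
  exact Finset.card_lt_card
    (Finset.Icc_ssubset_Icc_left (h.1.le.trans h.2) h.1 le_rfl)

/-- The Chow polynomial of a finite graded bounded poset. -/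
noncomputable def chowPolynomial (P : Type*) [PartialOrder P] [BoundedOrder P]
    [LocallyFiniteOrder P] [DecidableEq P] : ℤ[X] :=
  intervalChowPoly (⊥ : P) ⊤

/-- The augmented Chow polynomial `∑ s, x^(rk s) H_{s, 1}` of a finite graded bounded poset. -/
noncomputable def augmentedChowPolynomial (P : Type*) [PartialOrder P] [BoundedOrder P]
    [LocallyFiniteOrder P] [DecidableEq P] : ℤ[X] :=
  ∑ s ∈ Finset.Icc (⊥ : P) ⊤, X ^ posetRank s * intervalChowPoly s ⊤

end Chow

/-- A polynomial is real-rooted if all its complex zeros are real. (The zero polynomial is not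
real-rooted in this sense.) -/
def RealRooted (p : ℤ[X]) : Prop := ∀ z : ℂ, aeval z p = 0 → z.im = 0

/-! ## Dowling geometries -/

/-- A `G`-prepartition of `[n] = {1, …, n}`: a partition of `{0, 1, …, n}`, given by the
equivalence relation `part`, and a labeling by elements of `G` of the elements that do not lie in
the zero block, that is, in the block that contains `0`. -/
structure GPrepartition (n : ℕ) (G : Type*) where
  part : Setoid (Fin (n + 1))
  label : {i : Fin (n + 1) // ¬ part i 0} → G

namespace GPrepartition

variable {n : ℕ} {G : Type*}

/-- The order of `G`-prepartitions, `a` being below `b`: every nonzero block of `b` is a union of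
nonzero blocks of `a` (each element `i` of a nonzero block of `b` lies in a nonzero block of `a`,
and the `a`-block of `i` is contained in the `b`-block of `i`), and the labelings coincide on the
nonzero blocks of `b`. -/
def Below (a b : GPrepartition n G) : Prop :=
  ∀ (i : Fin (n + 1)) (hb : ¬ b.part i 0),
    ∃ ha : ¬ a.part i 0, (∀ j, a.part i j → b.part i j) ∧ a.label ⟨i, ha⟩ = b.label ⟨i, hb⟩

/-- Two `G`-prepartitions are equivalent if the partitions agree and on every nonzero block the
labelings differ by left multiplication with an element of `G`. -/
def Equivalent [Mul G] (a b : GPrepartition n G) : Prop :=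
  a.part = b.part ∧
    ∀ i : Fin (n + 1), ¬ a.part i 0 → ∃ g : G, ∀ (j : Fin (n + 1)) (ha : ¬ a.part j 0)
      (hb : ¬ b.part j 0), a.part i j → a.label ⟨j, ha⟩ = g * b.label ⟨j, hb⟩

theorem equivalent_refl [Group G] (a : GPrepartition n G) : Equivalent a a :=
  ⟨rfl, fun _ _ => ⟨1, fun _ _ _ _ => (one_mul _).symm⟩⟩

theorem equivalent_symm [Group G] {a b : GPrepartition n G} (h : Equivalent a b) :
    Equivalent b a := by
  obtain ⟨p, l⟩ := a
  obtain ⟨q, m⟩ := b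
  obtain ⟨hp, h⟩ := h
  dsimp only at hp h
  subst hp
  refine ⟨rfl, fun i hi => ?_⟩
  obtain ⟨g, hg⟩ := h i hi
  exact ⟨g⁻¹, fun j ha hb hij => by
    have e := hg j hb ha hij
    dsimp only at e ⊢
    rw [e, inv_mul_cancel_left]⟩

theorem equivalent_trans [Group G] {a b c : GPrepartition n G} (h : Equivalent a b)
    (h' : Equivalent b c) : Equivalent a c := by
  obtain ⟨p, l⟩ := a
  obtain ⟨q, m⟩ := b
  obtain ⟨r, k⟩ := c
  obtain ⟨hp, h⟩ := h
  obtain ⟨hq, h'⟩ := h'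
  dsimp only at hp h hq h'
  subst hp
  subst hq
  refine ⟨rfl, fun i hi => ?_⟩
  obtain ⟨g, hg⟩ := h i hi
  obtain ⟨g', hg'⟩ := h' i hi
  exact ⟨g * g', fun j ha hb hij => by
    have e := hg j ha ha hij
    have e' := hg' j ha hb hij
    dsimp only at e e' ⊢
    rw [e, e', mul_assoc]⟩

/-- Equivalence of `G`-prepartitions as a setoid. -/
instance setoid (n : ℕ) (G : Type*) [Group G] : Setoid (GPrepartition n G) where
  r := Equivalent
  iseqv := ⟨equivalent_refl, equivalent_symm, equivalent_trans⟩

theorem below_refl (a : GPrepartition n G) : Below a a :=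
  fun _ hi => ⟨hi, fun _ h => h, rfl⟩

theorem below_trans {a b c : GPrepartition n G} (h : Below a b) (h' : Below b c) :
    Below a c := by
  intro i hi
  obtain ⟨hb, hbc, e⟩ := h' i hi
  obtain ⟨ha, hab, e'⟩ := h i hb
  exact ⟨ha, fun j hj => hbc j (hab j hj), e'.trans e⟩

theorem part_le_of_below {a b : GPrepartition n G} (h : Below a b) {i j : Fin (n + 1)}
    (hij : a.part i j) : b.part i j := by
  by_cases hi : b.part i 0
  · by_cases hj : b.part j 0
    · exact b.part.trans' hi (b.part.symm' hj)
    · exact b.part.symm' ((h j hj).2.1 i (a.part.symm' hij))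
  · exact (h i hi).2.1 j hij

/-- If `a` is below `b` and `b'` is equivalent to `b`, then some `a'` equivalent to `a` is
below `b'`. -/
theorem exists_below_of_equivalent [Group G] {a b b' : GPrepartition n G} (h : Below a b)
    (hb : Equivalent b' b) : ∃ a', Equivalent a' a ∧ Below a' b' := by
  classical
  obtain ⟨q, m⟩ := b
  obtain ⟨q', m'⟩ := b'
  obtain ⟨hp, hb⟩ := hb
  dsimp only at hp hb
  subst hp
  refine ⟨⟨a.part, fun i => if hi : q' i.1 0 then a.label i else m' ⟨i.1, hi⟩⟩, ⟨rfl, ?_⟩, ?_⟩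
  · intro i hia
    dsimp only at hia ⊢
    by_cases hi : q' i 0
    · refine ⟨1, fun j hja _ hij => ?_⟩
      have hj : q' j 0 := q'.trans' (q'.symm' (part_le_of_below h hij)) hi
      rw [dif_pos hj, one_mul]
    · obtain ⟨g, hg⟩ := hb i hi
      refine ⟨g, fun j hja _ hij => ?_⟩
      have hij' : q' i j := part_le_of_below h hij
      have hj : ¬ q' j 0 := fun hj => hi (q'.trans' hij' hj)
      obtain ⟨_, _, e⟩ := h j hj
      rw [dif_neg hj, hg j hj hj hij', e]
  · intro i hi
    obtain ⟨hia, hsub, _⟩ := h i hi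
    exact ⟨hia, hsub, dif_neg hi⟩

end GPrepartition

/-- The Dowling geometry `Q_n(G)`: the set of `G`-partitions of `[n]`, that is, of equivalence
classes of `G`-prepartitions. -/
def DowlingGeometry (n : ℕ) (G : Type*) [Group G] : Type _ :=
  Quotient (GPrepartition.setoid n G)

namespace DowlingGeometry

open GPrepartition

variable {n : ℕ} {G : Type*} [Group G]

/-- The order on `Q_n(G)` is induced by the order of `G`-prepartitions. -/
instance partialOrder : PartialOrder (DowlingGeometry n G) where
  le P Q := ∃ a b : GPrepartition n G,
    (Quotient.mk _ a : DowlingGeometry n G) = P ∧ (Quotient.mk _ b : DowlingGeometry n G) = Q ∧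
      Below a b
  le_refl P := by
    obtain ⟨a, rfl⟩ := Quotient.exists_rep P
    exact ⟨a, a, rfl, rfl, below_refl a⟩
  le_trans P Q R := by
    rintro ⟨a, b, rfl, rfl, hab⟩ ⟨b', c, hb, rfl, hbc⟩
    obtain ⟨a', ha, h⟩ := exists_below_of_equivalent hab (Quotient.exact hb)
    exact ⟨a', c, Quotient.sound ha, rfl, below_trans h hbc⟩
  le_antisymm P Q := by
    rintro ⟨a, b, rfl, rfl, hab⟩ ⟨b', a', hb, ha, hba⟩
    have eb : b'.part = b.part := (Quotient.exact hb).1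
    have ea : a'.part = a.part := (Quotient.exact ha).1
    refine Quotient.sound ⟨?_, ?_⟩
    · refine Setoid.ext fun i j => ⟨part_le_of_below hab, fun h => ?_⟩
      rw [← ea]
      exact part_le_of_below hba (eb ▸ h)
    · intro i hi
      refine ⟨1, fun j _ hj _ => ?_⟩
      obtain ⟨_, _, e⟩ := hab j hj
      rw [one_mul, e]

/-- The minimum of `Q_n(G)` has the partition into singletons; the maximum has the zero block
`{0, 1, …, n}` as its only block. -/
instance boundedOrder : BoundedOrder (DowlingGeometry n G) where
  bot := Quotient.mk _ ⟨⊥, fun _ => 1⟩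
  top := Quotient.mk _ ⟨⊤, fun i => (i.2 trivial).elim⟩
  bot_le P := by
    classical
    obtain ⟨a, rfl⟩ := Quotient.exists_rep P
    refine ⟨⟨⊥, fun i => if hi : a.part i.1 0 then 1 else a.label ⟨i.1, hi⟩⟩, a,
      Quotient.sound ⟨rfl, ?_⟩, rfl, ?_⟩
    · intro i hi
      refine ⟨if hi : a.part i 0 then 1 else a.label ⟨i, hi⟩, ?_⟩
      rintro j _ _ hij
      obtain rfl : i = j := hij
      exact (mul_one _).symm
    · intro i hi
      refine ⟨?_, ?_, dif_neg hi⟩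
      · intro h
        obtain rfl : i = 0 := h
        exact hi (a.part.refl' _)
      · intro j h
        obtain rfl : i = j := h
        exact a.part.refl' _
  le_top P := by
    obtain ⟨a, rfl⟩ := Quotient.exists_rep P
    exact ⟨a, _, rfl, rfl, fun i hi => (hi trivial).elim⟩

instance finite [Finite G] : Finite (DowlingGeometry n G) := by
  have hS : Finite (Setoid (Fin (n + 1))) :=
    Finite.of_injective (fun (r : Setoid (Fin (n + 1))) i j => r i j)
      fun r s h => Setoid.ext fun i j => iff_of_eq (congrFun (congrFun h i) j)
  have : Finite (GPrepartition n G) :=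
    Finite.of_surjective
      (fun x : (Σ p : Setoid (Fin (n + 1)), ({i : Fin (n + 1) // ¬ p i 0} → G)) =>
        (⟨x.1, x.2⟩ : GPrepartition n G)) fun a => ⟨⟨a.part, a.label⟩, rfl⟩
  exact Quotient.finite _

noncomputable instance fintype [Finite G] : Fintype (DowlingGeometry n G) := Fintype.ofFinite _

noncomputable instance decidableEq : DecidableEq (DowlingGeometry n G) := Classical.decEq _

open Classical in
noncomputable instance locallyFiniteOrder [Finite G] :
    LocallyFiniteOrder (DowlingGeometry n G) := Fintype.toLocallyFiniteOrder

end DowlingGeometry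

/-! ## Intersection lattices of the braid arrangements -/

/-- The intersection lattice of an arrangement `A` of hyperplanes of `V`: all intersections of
members of `A` (including the empty intersection `V`), ordered by reverse inclusion. For a finite
linear arrangement this is the lattice of flats of the matroid of the arrangement. -/
abbrev IntersectionLattice {V : Type*} [AddCommGroup V] [Module ℂ V] (A : Set (Submodule ℂ V)) :
    Type _ :=
  {W : Submodule ℂ V // ∃ S ⊆ A, W = sInf S}ᵒᵈ

/-- The type A braid arrangement in `ℂ^m`: the hyperplanes `x_i = x_j` for `i < j`. -/
def braidArrangementA (m : ℕ) : Set (Submodule ℂ (Fin m → ℂ)) :=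
  {H | ∃ i j : Fin m, i < j ∧ (H : Set (Fin m → ℂ)) = {x | x i = x j}}

/-- The type B braid arrangement in `ℂ^m`: the hyperplanes `x_i = x_j` and `x_i = -x_j` for
`i < j`, and the coordinate hyperplanes `x_k = 0`. -/
def braidArrangementB (m : ℕ) : Set (Submodule ℂ (Fin m → ℂ)) :=
  {H | (∃ i j : Fin m, i < j ∧ (H : Set (Fin m → ℂ)) = {x | x i = x j}) ∨
    (∃ i j : Fin m, i < j ∧ (H : Set (Fin m → ℂ)) = {x | x i = -x j}) ∨
    ∃ k : Fin m, (H : Set (Fin m → ℂ)) = {x | x k = 0}}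

/-! Let m = |G| and let the corank of an element be its number of nonzero blocks. The number of
elements of corank j above an element of corank c depends only on c and j: it is T(c, j) =
h_{c-j}(a_0, …, a_j) with a_i = 1 + m i. Indeed, elements of Q_n(G) are kernels of maps from {0, …,
n} to free pointed G-sets. Sorting the maps into a set with k free orbits by their kernels gives
∑_{w ≥ s} (k)_{cork w} m^{cork w} = (1 + m k)^{cork s}, with (k)_j the falling factorial, and this
determines the counts. All four polynomials therefore come from scalar recursions in the corank
(`sum_Icc_eq_rowSum`), with T as the only input.

Real-rootedness is proved as nonvanishing at nonreal points. Real polynomials f, g interlace when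
the argument of g(t)/f(t) stays in [0, π] on the upper half-plane; at one fixed t this is the sign
condition `wedge (f t) (g t) ≥ 0`. Such conditions survive the recursions because the cross products
of block sums expand into nonnegative terms, and vectors in a sector smaller than a half-turn cannot
cancel.

Chains: let R_j be the row sum that uses only the parameters from a_j on. The recursion for the
h-polynomial turns into R_j' = y ∑_{i<j} a_i R_i + ∑_{i≥j} a_i R_i, an Eulerian recursion that
preserves interlacing (`InterlacedAt.step`); the last R_j is y times the h-polynomial of the proper
part.

Chow polynomials: Möbius inversion turns the definition into ∑_w x^{rk w - rk s} H_w = x ∑_w H_w +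
(1 - x), both sums over w ≥ s (`weightedChowSum_eq`). Comparing the tails of the two sums yields a
gamma-expansion: up to powers of 1 + x, the solutions are generating functions at t = x/(1+x)² of
weighted words without double ascents (`wordPair_eq_tailSum`). Their recursion preserves a
two-family version of interlacing (`InterlacedPairAt.step`), which settles Im t > 0; conjugation
covers Im t < 0. If x is nonreal and t is real, then t > 0 and the sums have positive terms.

The braid arrangements follow from the same description by kernels: the coordinate functions
restricted to a subspace form a map to a pointed G-set, where G is trivial or acts by signs. -/

/-! ## Triangular arrays of complete homogeneous type -/

/-- The array of complete homogeneous symmetric functions `h_{n-k}(a_0, …, a_k)`. -/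
def triangle (a : ℕ → ℕ) : ℕ → ℕ → ℕ
  | 0, 0 => 1
  | 0, _ + 1 => 0
  | n + 1, 0 => a 0 * triangle a n 0
  | n + 1, k + 1 => triangle a n k + a (k + 1) * triangle a n (k + 1)

theorem triangle_succ_zero (a : ℕ → ℕ) (n : ℕ) : triangle a (n + 1) 0 = a 0 * triangle a n 0 := by
  rw [triangle]

theorem triangle_succ_succ (a : ℕ → ℕ) (n k : ℕ) :
    triangle a (n + 1) (k + 1) = triangle a n k + a (k + 1) * triangle a n (k + 1) := by
  rw [triangle]

theorem triangle_eq_zero (a : ℕ → ℕ) : ∀ {n k : ℕ}, n < k → triangle a n k = 0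
  | 0, k + 1, _ => by rw [triangle]
  | n + 1, k + 1, h => by
    rw [triangle, triangle_eq_zero a (by omega), triangle_eq_zero a (by omega), mul_zero, add_zero]

theorem triangle_self (a : ℕ → ℕ) : ∀ n : ℕ, triangle a n n = 1
  | 0 => by rw [triangle]
  | n + 1 => by rw [triangle, triangle_self a n, triangle_eq_zero a (by omega), mul_zero, add_zero]

/-- The recursion that removes the first parameter `a_0`. -/
theorem triangle_succ_succ_shift (a : ℕ → ℕ) (n : ℕ) : ∀ k : ℕ,
    triangle a (n + 1) (k + 1) =
      triangle (fun i => a (i + 1)) n k + a 0 * triangle a n (k + 1) := by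
  induction n with
  | zero =>
    intro k
    cases k <;> simp [triangle]
  | succ n ih =>
    intro k
    cases k with
    | zero =>
      conv_lhs => rw [triangle_succ_succ, ih 0, triangle_succ_zero]
      rw [triangle_succ_succ a n, triangle_succ_zero]
      ring
    | succ k =>
      conv_lhs => rw [triangle_succ_succ, ih k, ih (k + 1)]
      rw [triangle_succ_succ a n, triangle_succ_succ _ n]
      ring

/-- The weighted row sum `∑ k, T(n, k) z^(n - k) f_k`. -/
noncomputable def rowSum (a : ℕ → ℕ) (z : ℂ) (f : ℕ → ℂ) (n : ℕ) : ℂ :=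
  ∑ k ∈ Finset.range (n + 1), (triangle a n k : ℂ) * z ^ (n - k) * f k

theorem rowSum_zero (a : ℕ → ℕ) (z : ℂ) (f : ℕ → ℂ) : rowSum a z f 0 = f 0 := by
  simp [rowSum, triangle]

/-- This is `triangle_succ_succ_shift` summed over a row. It splits off a_0, so iterating it peels
the parameters off one at a time. -/
theorem rowSum_succ (a : ℕ → ℕ) (z : ℂ) (f : ℕ → ℂ) (n : ℕ) :
    rowSum a z f (n + 1) =
      rowSum (fun i => a (i + 1)) z (fun i => f (i + 1)) n + a 0 * z * rowSum a z f n := by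
  have h1 : rowSum a z f n = ∑ k ∈ Finset.range (n + 1),
      (triangle a n (k + 1) : ℂ) * z ^ (n - (k + 1)) * f (k + 1) +
        (triangle a n 0 : ℂ) * z ^ n * f 0 := by
    have h := Finset.sum_range_succ'
      (fun k => (triangle a n k : ℂ) * z ^ (n - k) * f k) (n + 1)
    rw [Finset.sum_range_succ _ (n + 1), triangle_eq_zero a (Nat.lt_succ_self n)] at h
    simpa [rowSum] using h
  rw [h1, rowSum, Finset.sum_range_succ', rowSum, mul_add, Finset.mul_sum, ← add_assoc,
    ← Finset.sum_add_distrib]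
  congr 1
  · refine Finset.sum_congr rfl fun k hk => ?_
    have hk : k ≤ n := Nat.lt_succ_iff.1 (Finset.mem_range.1 hk)
    rw [triangle_succ_succ_shift, Nat.add_sub_add_right]
    rcases hk.eq_or_lt with rfl | hk
    · rw [triangle_eq_zero a (Nat.lt_succ_self k)]
      simp
    · rw [show n - k = (n - (k + 1)) + 1 by omega]
      push_cast
      ring
  · rw [triangle, Nat.sub_zero]
    push_cast
    ring

theorem rowSum_eq_range_add (a : ℕ → ℕ) (z : ℂ) (f : ℕ → ℂ) (n : ℕ) :
    rowSum a z f n =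
      ∑ k ∈ Finset.range n, (triangle a n k : ℂ) * z ^ (n - k) * f k + f n := by
  rw [rowSum, Finset.sum_range_succ, triangle_self, Nat.sub_self]
  simp

/-- The part of the weighted row sum that only uses the parameters from index `j` on. -/
noncomputable def tailSum (a : ℕ → ℕ) (z : ℂ) (f : ℕ → ℂ) (n j : ℕ) : ℂ :=
  rowSum (fun i => a (i + j)) z (fun i => f (i + j)) (n - j)

theorem tailSum_zero (a : ℕ → ℕ) (z : ℂ) (f : ℕ → ℂ) (n : ℕ) :
    tailSum a z f n 0 = rowSum a z f n := rfl

theorem tailSum_self (a : ℕ → ℕ) (z : ℂ) (f : ℕ → ℂ) (n : ℕ) : tailSum a z f n n = f n := by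
  rw [tailSum, Nat.sub_self, rowSum_zero, Nat.zero_add]

theorem tailSum_succ (a : ℕ → ℕ) (z : ℂ) (f : ℕ → ℂ) {n j : ℕ} (h : j ≤ n) :
    tailSum a z f (n + 1) j = tailSum a z f (n + 1) (j + 1) + a j * z * tailSum a z f n j := by
  rw [tailSum, Nat.succ_sub h, rowSum_succ, tailSum, tailSum, Nat.add_sub_add_right]
  simp only [Nat.zero_add, Nat.add_assoc, Nat.add_comm 1 j]

/-- Telescoping of `tailSum_succ` from j up to n + 1, where the tail is f(n + 1) alone. Tails of one
row thus become partial sums over the tails of the preceding row, the form to which interlacing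
applies. -/
theorem tailSum_eq_sum (a : ℕ → ℕ) (z : ℂ) (f : ℕ → ℂ) {n j : ℕ} (h : j ≤ n + 1) :
    tailSum a z f (n + 1) j =
      f (n + 1) + z * ∑ i ∈ Finset.Ico j (n + 1), (a i : ℂ) * tailSum a z f n i := by
  induction h using Nat.decreasingInduction with
  | self => rw [tailSum_self, Finset.Ico_self, Finset.sum_empty, mul_zero, add_zero]
  | of_succ j hj ih =>
    rw [tailSum_succ a z f (Nat.lt_succ_iff.1 hj), ih, Finset.sum_eq_sum_Ico_succ_bot hj]
    ring

/-! ## Planar cross products -/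

/-- The cross product of two vectors of the plane, `Im (v * conj u)`. -/
def wedge (u v : ℂ) : ℝ := u.re * v.im - u.im * v.re

theorem wedge_add_left (u v w : ℂ) : wedge (u + v) w = wedge u w + wedge v w := by
  simp only [wedge, Complex.add_re, Complex.add_im]; ring

theorem wedge_add_right (u v w : ℂ) : wedge u (v + w) = wedge u v + wedge u w := by
  simp only [wedge, Complex.add_re, Complex.add_im]; ring

theorem wedge_swap (u v : ℂ) : wedge u v = -wedge v u := by
  simp only [wedge]; ring

theorem wedge_self (u : ℂ) : wedge u u = 0 := by
  simp only [wedge]; ring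

theorem wedge_zero_left (u : ℂ) : wedge 0 u = 0 := by simp [wedge]

theorem wedge_zero_right (u : ℂ) : wedge u 0 = 0 := by simp [wedge]

theorem wedge_mul_mul (t u v : ℂ) : wedge (t * u) (t * v) = Complex.normSq t * wedge u v := by
  simp only [wedge, Complex.mul_re, Complex.mul_im, Complex.normSq_apply]; ring

theorem wedge_mul_self (t u : ℂ) : wedge u (t * u) = Complex.normSq u * t.im := by
  simp only [wedge, Complex.mul_re, Complex.mul_im, Complex.normSq_apply]; ring

theorem wedge_natCast_mul (a b : ℕ) (u v : ℂ) :
    wedge (a * u) (b * v) = a * b * wedge u v := by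
  simp only [wedge, Complex.mul_re, Complex.mul_im, Complex.natCast_re, Complex.natCast_im]; ring

theorem wedge_sum_left {ι : Type*} (s : Finset ι) (u : ι → ℂ) (v : ℂ) :
    wedge (∑ i ∈ s, u i) v = ∑ i ∈ s, wedge (u i) v := by
  induction s using Finset.cons_induction with
  | empty => simp [wedge]
  | cons i s hi ih => rw [Finset.sum_cons, wedge_add_left, ih, Finset.sum_cons]

theorem wedge_sum_sum_nonneg {ι κ : Type*} {s : Finset ι} {r : Finset κ} {u : ι → ℂ} {v : κ → ℂ}
    (h : ∀ i ∈ s, ∀ j ∈ r, 0 ≤ wedge (u i) (v j)) :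
    0 ≤ wedge (∑ i ∈ s, u i) (∑ j ∈ r, v j) := by
  rw [wedge_sum_left]
  refine Finset.sum_nonneg fun i hi => ?_
  rw [wedge_swap, wedge_sum_left, neg_nonneg]
  refine Finset.sum_nonpos fun j hj => ?_
  rw [wedge_swap, neg_nonpos]
  exact h i hi j hj

/-- Vectors `u`, `v` in a sector of angle less than a half-turn do not cancel. -/
theorem eq_zero_of_add_eq_zero {t u v : ℂ} (ht : 0 < t.im) (h : 0 ≤ wedge v (t * u))
    (e : u + v = 0) : u = 0 := by
  rw [← neg_eq_iff_add_eq_zero] at e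
  rw [← e] at h
  have h1 : wedge (-u) (t * u) = -(Complex.normSq u * t.im) := by
    rw [← wedge_mul_self]
    simp only [wedge, Complex.neg_re, Complex.neg_im]
    ring
  rw [h1, neg_nonneg] at h
  exact Complex.normSq_eq_zero.1
    (le_antisymm (nonpos_of_mul_nonpos_left h ht) (Complex.normSq_nonneg u))

/-- Every term lies at most a half-turn clockwise from t u_j, and u_j lies strictly inside that
half-plane, so the other terms cannot cancel it. -/
theorem sum_Ico_ne_zero {t : ℂ} (ht : 0 < t.im) {u : ℕ → ℂ} {j N : ℕ} (hj : j < N)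
    (h1 : ∀ i, j ≤ i → i < N → 0 ≤ wedge (u i) (t * u j)) (h2 : u j ≠ 0) :
    ∑ i ∈ Finset.Ico j N, u i ≠ 0 := by
  rw [Finset.sum_eq_sum_Ico_succ_bot hj]
  intro h
  refine h2 (eq_zero_of_add_eq_zero ht ?_ h)
  rw [wedge_sum_left]
  exact Finset.sum_nonneg fun i hi => h1 i (by have := Finset.mem_Ico.1 hi; omega)
    (Finset.mem_Ico.1 hi).2

/-! ## Interlacing at a point of the upper half-plane -/

theorem wedge_sum_Ico_nonneg {u v : ℕ → ℂ} {i j k l : ℕ}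
    (h : ∀ p q, i ≤ p → p < j → k ≤ q → q < l → 0 ≤ wedge (u p) (v q)) :
    0 ≤ wedge (∑ p ∈ Finset.Ico i j, u p) (∑ q ∈ Finset.Ico k l, v q) :=
  wedge_sum_sum_nonneg fun p hp q hq =>
    h p q (Finset.mem_Ico.1 hp).1 (Finset.mem_Ico.1 hp).2 (Finset.mem_Ico.1 hq).1
      (Finset.mem_Ico.1 hq).2

theorem wedge_sum_Ico_mul_nonneg {t : ℂ} {u v : ℕ → ℂ} {i j k l : ℕ}
    (h : ∀ p q, i ≤ p → p < j → k ≤ q → q < l → 0 ≤ wedge (u p) (t * v q)) :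
    0 ≤ wedge (∑ p ∈ Finset.Ico i j, u p) (t * ∑ q ∈ Finset.Ico k l, v q) := by
  rw [Finset.mul_sum]
  exact wedge_sum_Ico_nonneg h

/-- The values at `t` of an interlacing sequence of `N` polynomials. -/
structure InterlacedAt (t : ℂ) (N : ℕ) (g : ℕ → ℂ) : Prop where
  le : ∀ i j, i ≤ j → j < N → 0 ≤ wedge (g i) (g j)
  ge : ∀ i j, i ≤ j → j < N → 0 ≤ wedge (g j) (t * g i)
  ne : ∀ i < N, g i ≠ 0

theorem InterlacedAt.smul {t : ℂ} {N : ℕ} {g : ℕ → ℂ} (h : InterlacedAt t N g) {b : ℕ → ℕ}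
    (hb : ∀ i, 0 < b i) : InterlacedAt t N fun i => b i * g i where
  le i j hij hj := by
    rw [wedge_natCast_mul]
    exact mul_nonneg (by positivity) (h.le i j hij hj)
  ge i j hij hj := by
    rw [mul_left_comm, wedge_natCast_mul]
    exact mul_nonneg (by positivity) (h.ge i j hij hj)
  ne i hi := mul_ne_zero (Nat.cast_ne_zero.2 (hb i).ne') (h.ne i hi)

/-- The Eulerian step, in which the terms before position j acquire a factor t. Each cross product
is expanded over consecutive blocks of the sum until only hypotheses and squares remain. -/
theorem InterlacedAt.step {t : ℂ} (ht : 0 < t.im) {N : ℕ} (hN : 0 < N) {g : ℕ → ℂ}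
    (h : InterlacedAt t N g) :
    InterlacedAt t (N + 1) fun j =>
      t * ∑ i ∈ Finset.Ico 0 j, g i + ∑ i ∈ Finset.Ico j N, g i where
  le j k hjk hk := by
    have hk := Nat.lt_succ_iff.1 hk
    rw [← Finset.sum_Ico_consecutive g (Nat.zero_le j) hjk,
      ← Finset.sum_Ico_consecutive g hjk hk]
    -- X, Y, Z are the sums over i < j, j ≤ i < k and i ≥ k. The product of Y with itself
    -- contributes |Y|² Im t, and the products of distinct blocks are nonnegative by `le` and `ge`.
    have e : ∀ X Y Z : ℂ, wedge (t * X + (Y + Z)) (t * (X + Y) + Z) =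
        Complex.normSq t * wedge X Y + wedge Y (t * X) + Complex.normSq Y * t.im + wedge Y Z +
          wedge Z (t * Y) := fun X Y Z => by
      simp only [wedge, Complex.add_re, Complex.add_im, Complex.mul_re, Complex.mul_im,
        Complex.normSq_apply]
      ring
    rw [e]
    have h1 := mul_nonneg (Complex.normSq_nonneg t) (wedge_sum_Ico_nonneg (u := g) (v := g)
      (i := 0) (j := j) (k := j) (l := k) fun p q _ _ _ _ => h.le p q (by omega) (by omega))
    have h2 := wedge_sum_Ico_mul_nonneg (t := t) (u := g) (v := g)
      (i := j) (j := k) (k := 0) (l := j) fun p q _ _ _ _ => h.ge q p (by omega) (by omega)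
    have h3 := mul_nonneg (Complex.normSq_nonneg (∑ i ∈ Finset.Ico j k, g i)) ht.le
    have h4 := wedge_sum_Ico_nonneg (u := g) (v := g)
      (i := j) (j := k) (k := k) (l := N) fun p q _ _ _ _ => h.le p q (by omega) (by omega)
    have h5 := wedge_sum_Ico_mul_nonneg (t := t) (u := g) (v := g)
      (i := k) (j := N) (k := j) (l := k) fun p q _ _ _ _ => h.ge q p (by omega) (by omega)
    positivity
  ge j k hjk hk := by
    have hk := Nat.lt_succ_iff.1 hk
    rw [← Finset.sum_Ico_consecutive g (Nat.zero_le j) hjk,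
      ← Finset.sum_Ico_consecutive g hjk hk]
    -- The square |tX + Z|² Im t absorbs the products of X with Z and of these blocks with
    -- themselves.
    have e : ∀ X Y Z : ℂ, wedge (t * (X + Y) + Z) (t * (t * X + (Y + Z))) =
        Complex.normSq (t * X + Z) * t.im + Complex.normSq t * wedge X Y +
          Complex.normSq t * wedge Y (t * X) + Complex.normSq t * wedge Y Z +
          wedge Z (t * Y) := fun X Y Z => by
      simp only [wedge, Complex.add_re, Complex.add_im, Complex.mul_re, Complex.mul_im,
        Complex.normSq_apply]
      ring
    rw [e]
    have h1 := mul_nonneg (Complex.normSq_nonneg t) (wedge_sum_Ico_nonneg (u := g) (v := g)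
      (i := 0) (j := j) (k := j) (l := k) fun p q _ _ _ _ => h.le p q (by omega) (by omega))
    have h2 := mul_nonneg (Complex.normSq_nonneg t) (wedge_sum_Ico_mul_nonneg (t := t) (u := g)
      (v := g) (i := j) (j := k) (k := 0) (l := j)
      fun p q _ _ _ _ => h.ge q p (by omega) (by omega))
    have h3 := mul_nonneg (Complex.normSq_nonneg (t * ∑ i ∈ Finset.Ico 0 j, g i +
      ∑ i ∈ Finset.Ico k N, g i)) ht.le
    have h4 := mul_nonneg (Complex.normSq_nonneg t) (wedge_sum_Ico_nonneg (u := g) (v := g)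
      (i := j) (j := k) (k := k) (l := N) fun p q _ _ _ _ => h.le p q (by omega) (by omega))
    have h5 := wedge_sum_Ico_mul_nonneg (t := t) (u := g) (v := g)
      (i := k) (j := N) (k := j) (l := k) fun p q _ _ _ _ => h.ge q p (by omega) (by omega)
    positivity
  ne j hj := by
    have t0 : t ≠ 0 := fun h => by simp [h] at ht
    have hX : 0 < j → ∑ i ∈ Finset.Ico 0 j, g i ≠ 0 := fun h0 =>
      sum_Ico_ne_zero ht h0 (fun i _ hi => h.ge 0 i (Nat.zero_le i) (by omega)) (h.ne 0 hN)
    have hZ : j < N → ∑ i ∈ Finset.Ico j N, g i ≠ 0 := fun h0 =>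
      sum_Ico_ne_zero ht h0 (fun i hi hi' => h.ge j i hi hi') (h.ne j h0)
    intro e
    -- If the second block is nonempty, it is nonzero and the first one cannot cancel it; at j = N
    -- only t times the full sum is left.
    rcases Nat.lt_succ_iff_lt_or_eq.1 hj with hj | rfl
    · rw [add_comm] at e
      refine hZ hj (eq_zero_of_add_eq_zero ht ?_ e)
      rw [wedge_mul_mul]
      exact mul_nonneg (Complex.normSq_nonneg t) (wedge_sum_Ico_nonneg fun p q _ _ _ _ =>
        h.le p q (by omega) (by omega))
    · rw [Finset.Ico_self, Finset.sum_empty, add_zero] at e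
      exact hX hN ((mul_eq_zero.1 e).resolve_left t0)

/-- The values at `t` of the polynomials that enumerate words without double ascents: `V` belongs
to the words that do not end with an ascent, `U` to those that do. -/
structure InterlacedPairAt (t : ℂ) (N : ℕ) (V U : ℕ → ℂ) : Prop where
  vv : ∀ i j, i ≤ j → j < N → 0 ≤ wedge (V i) (V j)
  vtv : ∀ i j, i ≤ j → j < N → 0 ≤ wedge (V j) (t * V i)
  vu : ∀ i j, i < N → j < N → 0 ≤ wedge (V i) (U j)
  utv : ∀ i j, i < N → j < N → 0 ≤ wedge (U j) (t * V i)
  ww : ∀ i j, i ≤ j → j < N → 0 ≤ wedge (V i + U i) (V j + U j)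
  wtw : ∀ i j, i ≤ j → j < N → 0 ≤ wedge (V j + U j) (t * (V i + U i))
  ne : ∀ i < N, V i + U i ≠ 0
  ne_zero : V 0 ≠ 0

namespace InterlacedPairAt

variable {t : ℂ} {N : ℕ} {V U : ℕ → ℂ}

theorem vw (h : InterlacedPairAt t N V U) (i j : ℕ) (hij : i ≤ j) (hj : j < N) :
    0 ≤ wedge (V i) (V j + U j) := by
  rw [wedge_add_right]
  exact add_nonneg (h.vv i j hij hj) (h.vu i j (by omega) hj)

theorem wtv (h : InterlacedPairAt t N V U) (i j : ℕ) (hij : i ≤ j) (hj : j < N) :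
    0 ≤ wedge (V j + U j) (t * V i) := by
  rw [wedge_add_left]
  exact add_nonneg (h.vtv i j hij hj) (h.utv i j (by omega) hj)

theorem smul (h : InterlacedPairAt t N V U) {b : ℕ → ℕ} (hb : ∀ i, 0 < b i) :
    InterlacedPairAt t N (fun i => b i * V i) fun i => b i * U i where
  vv i j hij hj := by
    rw [wedge_natCast_mul]
    exact mul_nonneg (by positivity) (h.vv i j hij hj)
  vtv i j hij hj := by
    rw [mul_left_comm, wedge_natCast_mul]
    exact mul_nonneg (by positivity) (h.vtv i j hij hj)
  vu i j hi hj := by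
    rw [wedge_natCast_mul]
    exact mul_nonneg (by positivity) (h.vu i j hi hj)
  utv i j hi hj := by
    rw [mul_left_comm, wedge_natCast_mul]
    exact mul_nonneg (by positivity) (h.utv i j hi hj)
  ww i j hij hj := by
    rw [← mul_add, ← mul_add, wedge_natCast_mul]
    exact mul_nonneg (by positivity) (h.ww i j hij hj)
  wtw i j hij hj := by
    rw [← mul_add, ← mul_add, mul_left_comm, wedge_natCast_mul]
    exact mul_nonneg (by positivity) (h.wtw i j hij hj)
  ne i hi := by
    rw [← mul_add]
    exact mul_ne_zero (Nat.cast_ne_zero.2 (hb i).ne') (h.ne i hi)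
  ne_zero := mul_ne_zero (Nat.cast_ne_zero.2 (hb 0).ne') h.ne_zero

/-- Partial sums of `V` interlace partial sums of `V + U`. -/
theorem wedge_sum_nonneg (h : InterlacedPairAt t N V U) {i j : ℕ} (hj : j ≤ N) :
    0 ≤ wedge (∑ p ∈ Finset.Ico 0 j, V p) (∑ p ∈ Finset.Ico i N, (V p + U p)) := by
  rw [Finset.sum_add_distrib, wedge_add_right]
  refine add_nonneg ?_ (wedge_sum_Ico_nonneg fun p q _ _ _ _ => h.vu p q (by omega) (by omega))
  rcases le_total j i with hij | hij
  · exact wedge_sum_Ico_nonneg fun p q _ _ _ _ => h.vv p q (by omega) (by omega)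
  -- The ranges overlap in [i, j); the overlap is common to both sums and its cross product with
  -- itself is zero.
  · rw [← Finset.sum_Ico_consecutive V (Nat.zero_le i) hij,
      ← Finset.sum_Ico_consecutive V hij hj]
    simp only [wedge_add_left, wedge_add_right, wedge_self]
    have h1 := wedge_sum_Ico_nonneg (u := V) (v := V) (i := 0) (j := i) (k := i) (l := j)
      fun p q _ _ _ _ => h.vv p q (by omega) (by omega)
    have h2 := wedge_sum_Ico_nonneg (u := V) (v := V) (i := 0) (j := i) (k := j) (l := N)
      fun p q _ _ _ _ => h.vv p q (by omega) (by omega)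
    have h3 := wedge_sum_Ico_nonneg (u := V) (v := V) (i := i) (j := j) (k := j) (l := N)
      fun p q _ _ _ _ => h.vv p q (by omega) (by omega)
    linarith

/-- Partial sums of `V + U` interlace `t` times partial sums of `V`. -/
theorem wedge_sum_mul_nonneg (ht : 0 < t.im) (h : InterlacedPairAt t N V U) {i j : ℕ}
    (hj : j ≤ N) :
    0 ≤ wedge (∑ p ∈ Finset.Ico i N, (V p + U p)) (t * ∑ p ∈ Finset.Ico 0 j, V p) := by
  rw [Finset.sum_add_distrib, wedge_add_left]
  refine add_nonneg ?_ (wedge_sum_Ico_mul_nonneg fun p q _ _ _ _ =>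
    h.utv q p (by omega) (by omega))
  rcases le_total j i with hij | hij
  · exact wedge_sum_Ico_mul_nonneg fun p q _ _ _ _ => h.vtv q p (by omega) (by omega)
  · rw [← Finset.sum_Ico_consecutive V (Nat.zero_le i) hij,
      ← Finset.sum_Ico_consecutive V hij hj]
    simp only [mul_add, wedge_add_left, wedge_add_right, wedge_mul_self]
    have h0 := mul_nonneg (Complex.normSq_nonneg (∑ i ∈ Finset.Ico i j, V i)) ht.le
    have h1 := wedge_sum_Ico_mul_nonneg (t := t) (u := V) (v := V)
      (i := i) (j := j) (k := 0) (l := i) fun p q _ _ _ _ => h.vtv q p (by omega) (by omega)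
    have h2 := wedge_sum_Ico_mul_nonneg (t := t) (u := V) (v := V)
      (i := j) (j := N) (k := 0) (l := i) fun p q _ _ _ _ => h.vtv q p (by omega) (by omega)
    have h3 := wedge_sum_Ico_mul_nonneg (t := t) (u := V) (v := V)
      (i := j) (j := N) (k := i) (l := j) fun p q _ _ _ _ => h.vtv q p (by omega) (by omega)
    linarith

theorem sum_ne_zero (ht : 0 < t.im) (hN : 0 < N) (h : InterlacedPairAt t N V U) :
    ∑ i ∈ Finset.Ico 0 N, V i ≠ 0 :=
  sum_Ico_ne_zero ht hN (fun i _ hi => h.vtv 0 i (Nat.zero_le i) hi) h.ne_zero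

/-- A non-ascent to j may follow any word ending in some i ≥ j, whereas an ascent to j, which costs
a factor t, may only follow a word that does not itself end with an ascent. Hence V_j' sums V + U
over i ≥ j and U_j' is t times the sum of V over i < j. -/
theorem step (ht : 0 < t.im) (hN : 0 < N) (h : InterlacedPairAt t N V U) :
    InterlacedPairAt t (N + 1) (fun j => ∑ i ∈ Finset.Ico j N, (V i + U i))
      fun j => t * ∑ i ∈ Finset.Ico 0 j, V i where
  vv j k hjk hk := by
    rw [← Finset.sum_Ico_consecutive _ hjk (Nat.lt_succ_iff.1 hk), wedge_add_left, wedge_self,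
      add_zero]
    exact wedge_sum_Ico_nonneg fun p q _ _ _ _ => h.ww p q (by omega) (by omega)
  vtv j k hjk hk := by
    rw [← Finset.sum_Ico_consecutive _ hjk (Nat.lt_succ_iff.1 hk), mul_add, wedge_add_right,
      wedge_mul_self]
    exact add_nonneg (wedge_sum_Ico_mul_nonneg fun p q _ _ _ _ => h.wtw q p (by omega) (by omega))
      (mul_nonneg (Complex.normSq_nonneg _) ht.le)
  vu _ j _ hj := h.wedge_sum_mul_nonneg ht (Nat.lt_succ_iff.1 hj)
  utv _ j _ hj := by
    rw [wedge_mul_mul]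
    exact mul_nonneg (Complex.normSq_nonneg t)
      (h.wedge_sum_nonneg (Nat.lt_succ_iff.1 hj))
  ww j k hjk hk := by
    have hk := Nat.lt_succ_iff.1 hk
    rw [← Finset.sum_Ico_consecutive V (Nat.zero_le j) hjk,
      ← Finset.sum_Ico_consecutive (fun i => V i + U i) hjk hk]
    -- X and Y' are the sums of V over i < j and j ≤ i < k; Y and Z are the sums of V + U over j ≤ i
    -- < k and i ≥ k.
    have e : ∀ X Y' Y Z : ℂ, wedge (Y + Z + t * X) (Z + t * (X + Y')) =
        Complex.normSq t * wedge X Y' + wedge Z (t * Y') + wedge Y (t * X) + wedge Y (t * Y') +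
          wedge Y Z := fun X Y' Y Z => by
      simp only [wedge, Complex.add_re, Complex.add_im, Complex.mul_re, Complex.mul_im,
        Complex.normSq_apply]
      ring
    rw [e]
    have h1 := mul_nonneg (Complex.normSq_nonneg t) (wedge_sum_Ico_nonneg (u := V) (v := V)
      (i := 0) (j := j) (k := j) (l := k) fun p q _ _ _ _ => h.vv p q (by omega) (by omega))
    have h2 := wedge_sum_Ico_mul_nonneg (t := t) (u := fun i => V i + U i) (v := V)
      (i := k) (j := N) (k := j) (l := k) fun p q _ _ _ _ => h.wtv q p (by omega) (by omega)
    have h3 := wedge_sum_Ico_mul_nonneg (t := t) (u := fun i => V i + U i) (v := V)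
      (i := j) (j := k) (k := 0) (l := j) fun p q _ _ _ _ => h.wtv q p (by omega) (by omega)
    have h4 : 0 ≤ wedge (∑ i ∈ Finset.Ico j k, (V i + U i)) (t * ∑ i ∈ Finset.Ico j k, V i) := by
      rw [Finset.sum_add_distrib, wedge_add_left, wedge_mul_self]
      exact add_nonneg (mul_nonneg (Complex.normSq_nonneg _) ht.le)
        (wedge_sum_Ico_mul_nonneg fun p q _ _ _ _ => h.utv q p (by omega) (by omega))
    have h5 := wedge_sum_Ico_nonneg (u := fun i => V i + U i) (v := fun i => V i + U i)
      (i := j) (j := k) (k := k) (l := N) fun p q _ _ _ _ => h.ww p q (by omega) (by omega)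
    positivity
  wtw j k hjk hk := by
    have hk := Nat.lt_succ_iff.1 hk
    rw [← Finset.sum_Ico_consecutive V (Nat.zero_le j) hjk,
      ← Finset.sum_Ico_consecutive (fun i => V i + U i) hjk hk]
    have e : ∀ X Y' Y Z : ℂ, wedge (Z + t * (X + Y')) (t * (Y + Z + t * X)) =
        Complex.normSq (t * X + Z) * t.im + Complex.normSq t * wedge X Y + wedge Z (t * Y) +
          Complex.normSq t * wedge Y' (t * X) + Complex.normSq t * wedge Y' Z +
          Complex.normSq t * wedge Y' Y := fun X Y' Y Z => by
      simp only [wedge, Complex.add_re, Complex.add_im, Complex.mul_re, Complex.mul_im,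
        Complex.normSq_apply]
      ring
    rw [e]
    have h0 := mul_nonneg (Complex.normSq_nonneg (t * ∑ i ∈ Finset.Ico 0 j, V i +
      ∑ i ∈ Finset.Ico k N, (V i + U i))) ht.le
    have h1 := mul_nonneg (Complex.normSq_nonneg t) (wedge_sum_Ico_nonneg (u := V)
      (v := fun i => V i + U i) (i := 0) (j := j) (k := j) (l := k)
      fun p q _ _ _ _ => h.vw p q (by omega) (by omega))
    have h2 := wedge_sum_Ico_mul_nonneg (t := t) (u := fun i => V i + U i)
      (v := fun i => V i + U i) (i := k) (j := N) (k := j) (l := k)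
      fun p q _ _ _ _ => h.wtw q p (by omega) (by omega)
    have h3 := mul_nonneg (Complex.normSq_nonneg t) (wedge_sum_Ico_mul_nonneg (t := t) (u := V)
      (v := V) (i := j) (j := k) (k := 0) (l := j)
      fun p q _ _ _ _ => h.vtv q p (by omega) (by omega))
    have h4 := mul_nonneg (Complex.normSq_nonneg t) (wedge_sum_Ico_nonneg (u := V)
      (v := fun i => V i + U i) (i := j) (j := k) (k := k) (l := N)
      fun p q _ _ _ _ => h.vw p q (by omega) (by omega))
    have h5 : 0 ≤ wedge (∑ i ∈ Finset.Ico j k, V i) (∑ i ∈ Finset.Ico j k, (V i + U i)) := by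
      rw [Finset.sum_add_distrib, wedge_add_right, wedge_self, zero_add]
      exact wedge_sum_Ico_nonneg fun p q _ _ _ _ => h.vu p q (by omega) (by omega)
    have h6 := mul_nonneg (Complex.normSq_nonneg t) h5
    positivity
  ne j hj := by
    intro e
    rcases Nat.lt_succ_iff_lt_or_eq.1 hj with hj | rfl
    · refine sum_Ico_ne_zero ht hj (fun i hi hi' => h.wtw j i hi hi') (h.ne j hj)
        (eq_zero_of_add_eq_zero ht ?_ e)
      rw [wedge_mul_mul]
      exact mul_nonneg (Complex.normSq_nonneg t) (h.wedge_sum_nonneg hj.le)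
    · rw [Finset.Ico_self, Finset.sum_empty, zero_add] at e
      have t0 : t ≠ 0 := fun h => by simp [h] at ht
      exact h.sum_ne_zero ht hN ((mul_eq_zero.1 e).resolve_left t0)
  ne_zero := sum_Ico_ne_zero ht hN (fun i _ hi => h.wtw 0 i (Nat.zero_le i) hi) (h.ne 0 hN)

end InterlacedPairAt

/-! ## Nonvanishing of the solutions of the two recursions -/

/-- The tails of the chain recursion obey the Eulerian step. Only indices j ≤ n enter `InterlacedAt
y (n + 1)`, so the default value 0 is never read. -/
theorem interlacedAt_tailSum {a : ℕ → ℕ} (ha : ∀ i, 0 < a i) {y : ℂ} (hy : 0 < y.im)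
    {h : ℕ → ℂ} (h0 : h 0 = 1) (hrec : ∀ n, h (n + 1) = y * rowSum a (1 - y) h (n + 1)) (n : ℕ) :
    InterlacedAt y (n + 1) (fun j => if j ≤ n then tailSum a (1 - y) h n j else 0) := by
  have hy1 : 1 - y ≠ 0 := fun e => by
    have := congrArg Complex.im e
    simp at this
    exact hy.ne' this
  induction n with
  | zero =>
    have e : tailSum a (1 - y) h 0 0 = 1 := by rw [tailSum_self, h0]
    have aux : ∀ i, i < 0 + 1 → (if i ≤ 0 then tailSum a (1 - y) h 0 i else 0) = 1 := by
      intro i hi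
      obtain rfl : i = 0 := by omega
      rw [if_pos le_rfl, e]
    refine ⟨fun i j hij hj => ?_, fun i j hij hj => ?_, fun i hi => ?_⟩
    · rw [aux i (by omega), aux j hj, wedge_self]
    · rw [aux i (by omega), aux j hj, wedge_mul_self]
      exact mul_nonneg (Complex.normSq_nonneg _) hy.le
    · rw [aux i hi]
      exact one_ne_zero
  | succ n ih =>
    have key : ∀ j ≤ n + 1, tailSum a (1 - y) h (n + 1) j =
        y * ∑ i ∈ Finset.Ico 0 j, (a i : ℂ) * (if i ≤ n then tailSum a (1 - y) h n i else 0) +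
          ∑ i ∈ Finset.Ico j (n + 1),
            (a i : ℂ) * (if i ≤ n then tailSum a (1 - y) h n i else 0) := by
      intro j hj
      have hs : ∀ k l, l ≤ n + 1 → ∑ i ∈ Finset.Ico k l,
          (a i : ℂ) * (if i ≤ n then tailSum a (1 - y) h n i else 0) =
            ∑ i ∈ Finset.Ico k l, (a i : ℂ) * tailSum a (1 - y) h n i := fun k l hl =>
        Finset.sum_congr rfl fun i hi => by
          rw [if_pos (by have := Finset.mem_Ico.1 hi; omega)]
      rw [hs 0 j hj, hs j (n + 1) le_rfl]
      have e1 := tailSum_eq_sum a (1 - y) h hj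
      have e0 := tailSum_eq_sum a (1 - y) h (Nat.zero_le (n + 1))
      have e2 := hrec n
      rw [← tailSum_zero, e0] at e2
      have e3 := Finset.sum_Ico_consecutive (fun i => (a i : ℂ) * tailSum a (1 - y) h n i)
        (Nat.zero_le j) hj
      -- The recursion has h(n + 1) on both sides; collecting it leaves a factor 1 - y that cancels.
      -- Consequently the constant term of each tail is y times the full sum, which merges with the
      -- (1 - y)-weighted part.
      have e4 : h (n + 1) =
          y * ∑ i ∈ Finset.Ico 0 (n + 1), (a i : ℂ) * tailSum a (1 - y) h n i := by
        apply mul_left_cancel₀ hy1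
        linear_combination e2
      rw [e1, e4, ← e3]
      ring
    have st := (ih.smul ha).step hy (Nat.succ_pos n)
    refine ⟨fun i j hij hj => ?_, fun i j hij hj => ?_, fun i hi => ?_⟩
    · rw [if_pos (by omega), if_pos (by omega), key i (by omega), key j (by omega)]
      exact st.le i j hij hj
    · rw [if_pos (by omega), if_pos (by omega), key i (by omega), key j (by omega)]
      exact st.ge i j hij hj
    · rw [if_pos (by omega), key i (by omega)]
      exact st.ne i hi

/-- The value h n is the last tail of its own row. -/
theorem ne_zero_of_chain_recursion {a : ℕ → ℕ} (ha : ∀ i, 0 < a i) {y : ℂ} (hy : 0 < y.im)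
    {h : ℕ → ℂ} (h0 : h 0 = 1) (hrec : ∀ n, h (n + 1) = y * rowSum a (1 - y) h (n + 1)) (n : ℕ) :
    h n ≠ 0 := by
  have := (interlacedAt_tailSum ha hy h0 hrec n).ne n (Nat.lt_succ_self n)
  rwa [if_pos le_rfl, tailSum_self] at this

/-- The generating functions at `t` of words `i_1 ⋯ i_n` with `i_k < k`, without double ascents,
weighted by the parameters `a` of their letters and by the number of ascents. In position `j` the
words are followed by a letter `j`: the last step is not an ascent for the first component, and is
an ascent for the second one. -/
noncomputable def wordPair (a : ℕ → ℕ) (t : ℂ) : ℕ → (ℕ → ℂ) × (ℕ → ℂ)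
  | 0 => (fun _ => 1, fun _ => 0)
  | n + 1 =>
    (fun j => ∑ i ∈ Finset.Ico j (n + 1),
      ((a i : ℂ) * (wordPair a t n).1 i + (a i : ℂ) * (wordPair a t n).2 i),
    fun j => t * ∑ i ∈ Finset.Ico 0 j, (a i : ℂ) * (wordPair a t n).1 i)

theorem interlacedPairAt_wordPair {a : ℕ → ℕ} (ha : ∀ i, 0 < a i) {t : ℂ} (ht : 0 < t.im)
    (n : ℕ) : InterlacedPairAt t (n + 1) (wordPair a t n).1 (wordPair a t n).2 := by
  induction n with
  | zero =>
    have h : 0 ≤ wedge 1 (t * 1) := by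
      rw [wedge_mul_self]
      exact mul_nonneg (Complex.normSq_nonneg _) ht.le
    constructor <;> intros <;>
      simp [wordPair, wedge_self, wedge_zero_left, wedge_zero_right, -mul_one, h]
  | succ n ih => exact (ih.smul ha).step ht (Nat.succ_pos n)

theorem sum_wordPair_ne_zero {a : ℕ → ℕ} (ha : ∀ i, 0 < a i) {t : ℂ} (ht : 0 < t.im) (n : ℕ) :
    ∑ i ∈ Finset.Ico 0 (n + 1), (a i : ℂ) * (wordPair a t n).1 i ≠ 0 :=
  ((interlacedPairAt_wordPair ha ht n).smul ha).sum_ne_zero ht (Nat.succ_pos n)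

section Positive

open scoped ComplexOrder

/-- Positive real t lies outside the reach of the half-plane argument, but there the recursion has
no subtractions. -/
theorem wordPair_nonneg (a : ℕ → ℕ) {t : ℂ} (ht : 0 < t) (n : ℕ) :
    ∀ j, 0 ≤ (wordPair a t n).1 j ∧ 0 ≤ (wordPair a t n).2 j := by
  induction n with
  | zero => exact fun j => ⟨zero_le_one, le_rfl⟩
  | succ n ih =>
    have ha : ∀ i, (0 : ℂ) ≤ a i := fun i => Nat.cast_nonneg _
    exact fun j => ⟨Finset.sum_nonneg fun i _ =>
      add_nonneg (mul_nonneg (ha i) (ih i).1) (mul_nonneg (ha i) (ih i).2),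
      mul_nonneg ht.le (Finset.sum_nonneg fun i _ => mul_nonneg (ha i) (ih i).1)⟩

theorem wordPair_zero_pos {a : ℕ → ℕ} (ha : ∀ i, 0 < a i) {t : ℂ} (ht : 0 < t) (n : ℕ) :
    0 < (wordPair a t n).1 0 := by
  have ha' : ∀ i, (0 : ℂ) < a i := fun i => Nat.cast_pos.2 (ha i)
  induction n with
  | zero => exact zero_lt_one
  | succ n ih =>
    have h := wordPair_nonneg a ht n
    refine lt_of_lt_of_le (mul_pos (ha' 0) ih) (le_trans ?_ (Finset.single_le_sum (fun i _ =>
      add_nonneg (mul_nonneg (ha' i).le (h i).1) (mul_nonneg (ha' i).le (h i).2))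
      (Finset.mem_Ico.2 ⟨le_rfl, Nat.succ_pos n⟩)))
    exact le_add_of_nonneg_right (mul_nonneg (ha' 0).le (h 0).2)

theorem sum_wordPair_pos {a : ℕ → ℕ} (ha : ∀ i, 0 < a i) {t : ℂ} (ht : 0 < t) (n : ℕ) :
    0 < ∑ i ∈ Finset.Ico 0 (n + 1), (a i : ℂ) * (wordPair a t n).1 i := by
  have ha' : ∀ i, (0 : ℂ) < a i := fun i => Nat.cast_pos.2 (ha i)
  exact lt_of_lt_of_le (mul_pos (ha' 0) (wordPair_zero_pos ha ht n))
    (Finset.single_le_sum (f := fun i => (a i : ℂ) * (wordPair a t n).1 i)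
      (fun i _ => mul_nonneg (ha' i).le (wordPair_nonneg a ht n i).1)
      (Finset.mem_Ico.2 ⟨le_rfl, Nat.succ_pos n⟩))

/-- The inverse of x/(1+x)² is 2 + x + 1/x. For nonreal x this is real only on the unit circle,
where it equals 2 + 2 Re x > 0. -/
theorem div_one_add_sq_pos {x : ℂ} (hx : x.im ≠ 0) (ht : (x / (1 + x) ^ 2).im = 0) :
    0 < x / (1 + x) ^ 2 := by
  have h0 : x ≠ 0 := fun h => hx (by rw [h, Complex.zero_im])
  have h1 : 1 + x ≠ 0 := fun h => hx (by simpa using congrArg Complex.im h)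
  have e : (x / (1 + x) ^ 2)⁻¹ = 2 + (x + x⁻¹) := by
    field_simp
    ring
  have n0 : 0 < Complex.normSq x := Complex.normSq_pos.2 h0
  have him : ((x / (1 + x) ^ 2)⁻¹).im = 0 := by rw [Complex.inv_im, ht]; simp
  rw [e] at him
  have hn : Complex.normSq x = 1 := by
    rw [Complex.add_im, Complex.add_im, Complex.inv_im] at him
    field_simp at him
    simp at him
    rcases him with h | h
    · exact absurd h hx
    · linarith
  have hre : 0 < (2 + (x + x⁻¹)).re := by
    have h2 : Complex.normSq x = x.re * x.re + x.im * x.im := Complex.normSq_apply x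
    have h3 : 0 < x.im * x.im := mul_self_pos.2 hx
    rw [Complex.add_re, Complex.add_re, Complex.inv_re, hn, Complex.re_ofNat]
    nlinarith
  have hpos : 0 < (x / (1 + x) ^ 2)⁻¹ := by
    rw [e, Complex.pos_iff]
    exact ⟨hre, him.symm⟩
  exact inv_pos.1 hpos

end Positive

/-- The words without double ascents solve the Chow recursion. -/
theorem wordPair_eq_tailSum {a : ℕ → ℕ} (ha0 : a 0 = 1) {x : ℂ} (hx : x.im ≠ 0) {H : ℕ → ℂ}
    (hH : ∀ n, rowSum a x H n = x * rowSum a 1 H n + (1 - x)) (n : ℕ) :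
    rowSum a x H n = (1 + x) ^ n * (wordPair a (x / (1 + x) ^ 2) n).1 0 ∧
    (∀ j, 1 ≤ j → j ≤ n →
      x * (tailSum a 1 H n j - tailSum a x H n j) =
          (1 - x) * (1 + x) ^ n * (wordPair a (x / (1 + x) ^ 2) n).1 j ∧
        x * (tailSum a x H n j - x * tailSum a 1 H n j) =
          (1 - x) * (1 + x) ^ (n + 1) * (wordPair a (x / (1 + x) ^ 2) n).2 j) := by
  have h1 : 1 + x ≠ 0 := fun h => hx (by simpa using congrArg Complex.im h)
  have h1' : 1 - x ≠ 0 := fun h => hx (by simpa using congrArg Complex.im h)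
  obtain ⟨t, ht⟩ : ∃ t, t = x / (1 + x) ^ 2 := ⟨_, rfl⟩
  have htx : t * (1 + x) ^ 2 = x := by rw [ht]; field_simp
  rw [← ht]
  clear ht
  induction n with
  | zero =>
    refine ⟨?_, fun j h1 h2 => by omega⟩
    have e := hH 0
    rw [rowSum_zero, rowSum_zero] at e
    have e1 : H 0 = 1 := mul_left_cancel₀ h1' (by linear_combination e)
    simp [rowSum_zero, e1, wordPair]
  | succ n ih =>
    obtain ⟨ih0, ih1⟩ := ih
    have hU0 : (wordPair a t n).2 0 = 0 := by cases n <;> simp [wordPair]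
    have a0 : (a 0 : ℂ) = 1 := by rw [ha0, Nat.cast_one]
    have eA : ∀ j ≤ n + 1, tailSum a x H (n + 1) j = H (n + 1) +
        x * ∑ i ∈ Finset.Ico j (n + 1), (a i : ℂ) * tailSum a x H n i :=
      fun j hj => tailSum_eq_sum a x H hj
    have eB : ∀ j ≤ n + 1, tailSum a 1 H (n + 1) j = H (n + 1) +
        ∑ i ∈ Finset.Ico j (n + 1), (a i : ℂ) * tailSum a 1 H n i :=
      fun j hj => by rw [tailSum_eq_sum a 1 H hj, one_mul]
    have hn := hH n
    have hn1 := hH (n + 1)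
    rw [← tailSum_zero, ← tailSum_zero] at hn hn1
    rw [← tailSum_zero] at ih0
    -- Write A, B for the tails at z = x and z = 1. The two induction hypotheses combine through B -
    -- xA = (1 + x)(B - A) + (A - xB). They hold only from index 1 on; index 0 is governed by `hH`.
    have hV : ∀ j, 1 ≤ j → j ≤ n + 1 →
        x * (∑ i ∈ Finset.Ico j (n + 1), (a i : ℂ) * tailSum a 1 H n i -
          x * ∑ i ∈ Finset.Ico j (n + 1), (a i : ℂ) * tailSum a x H n i) =
        (1 - x) * (1 + x) ^ (n + 1) * (wordPair a t (n + 1)).1 j := by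
      intro j hj hjn
      simp only [wordPair]
      simp only [Finset.mul_sum, ← Finset.sum_sub_distrib]
      refine Finset.sum_congr rfl fun i hi => ?_
      obtain ⟨hi1, hi2⟩ := Finset.mem_Ico.1 hi
      obtain ⟨e1, e2⟩ := ih1 i (by omega) (by omega)
      linear_combination (a i : ℂ) * ((1 + x) * e1 + e2)
    have hW : ∀ j, 1 ≤ j → j ≤ n + 1 →
        x * ∑ i ∈ Finset.Ico 1 j, (a i : ℂ) * (tailSum a 1 H n i - tailSum a x H n i) =
        (1 - x) * (1 + x) ^ n * ∑ i ∈ Finset.Ico 1 j, (a i : ℂ) * (wordPair a t n).1 i := by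
      intro j hj hjn
      simp only [Finset.mul_sum]
      refine Finset.sum_congr rfl fun i hi => ?_
      obtain ⟨hi1, hi2⟩ := Finset.mem_Ico.1 hi
      obtain ⟨e1, e2⟩ := ih1 i (by omega) (by omega)
      linear_combination (a i : ℂ) * e1
    have hn1' := hn1
    rw [eA 0 (by omega), eB 0 (by omega)] at hn1'
    rw [Finset.sum_eq_sum_Ico_succ_bot (Nat.succ_pos n),
      Finset.sum_eq_sum_Ico_succ_bot (Nat.succ_pos n), a0, zero_add] at hn1'
    refine ⟨?_, fun j hj hjn => ⟨?_, ?_⟩⟩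
    -- The terms with i ≥ 1 are supplied by `hV`. The term i = 0 uses A_0 = x B_0 + (1 - x) from row
    -- n, and a_0 = 1 makes the constants 1 - x cancel.
    · rw [← tailSum_zero]
      have e := hV 1 le_rfl (by omega)
      have e0 : (wordPair a t (n + 1)).1 0 =
          (wordPair a t n).1 0 + (wordPair a t (n + 1)).1 1 := by
        simp only [wordPair]
        rw [Finset.sum_eq_sum_Ico_succ_bot (Nat.succ_pos n), a0, hU0]
        ring
      rw [e0, eA 0 (by omega), Finset.sum_eq_sum_Ico_succ_bot (Nat.succ_pos n), a0, zero_add]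
      apply mul_left_cancel₀ h1'
      linear_combination hn1' + e - hn + (1 - x) * (1 + x) * ih0
    · rw [eA j hjn, eB j hjn, ← hV j hj hjn]
      ring
    -- By `hn1'`, A_j - x B_j in row n + 1 equals (1 - x) + x ∑_{i<j} a_i (B_i - A_i) over row n.
    -- Since a_0 = 1, the constant and the term i = 0 add up to (1 - x) A_0.
    · have e := hW j hj hjn
      have e0 : (wordPair a t (n + 1)).2 j = t * ((wordPair a t n).1 0 +
          ∑ i ∈ Finset.Ico 1 j, (a i : ℂ) * (wordPair a t n).1 i) := by
        simp only [wordPair]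
        rw [Finset.sum_eq_sum_Ico_succ_bot (by omega), a0, zero_add, one_mul]
      have s1 := Finset.sum_Ico_consecutive (fun i => (a i : ℂ) * tailSum a x H n i) hj hjn
      have s2 := Finset.sum_Ico_consecutive (fun i => (a i : ℂ) * tailSum a 1 H n i) hj hjn
      simp only [mul_sub, Finset.sum_sub_distrib] at e
      rw [e0, eA j hjn, eB j hjn]
      rw [← s1, ← s2] at hn1'
      have p : (1 + x) ^ (n + 1 + 1) * t = (1 + x) ^ n * x := by
        linear_combination (1 + x) ^ n * htx
      have q : (1 - x) * (1 + x) ^ (n + 1 + 1) * (t * ((wordPair a t n).1 0 +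
          ∑ i ∈ Finset.Ico 1 j, (a i : ℂ) * (wordPair a t n).1 i)) =
          (1 - x) * ((1 + x) ^ n * x) * ((wordPair a t n).1 0 +
          ∑ i ∈ Finset.Ico 1 j, (a i : ℂ) * (wordPair a t n).1 i) := by
        rw [← p]; ring
      rw [q]
      linear_combination x * hn1' + x * e - x * hn + (1 - x) * x * ih0

-- The augmented value is a word count with letter 0 appended. For H(n + 1), both tails with j = n +
-- 1 reduce to H(n + 1), so the ascent relation expresses it through the words of length n.
open scoped ComplexOrder in
theorem ne_zero_of_chow_recursion {a : ℕ → ℕ} (ha0 : a 0 = 1) (ha : ∀ i, 0 < a i) {x : ℂ}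
    (hx : x.im ≠ 0) (ht : 0 ≤ (x / (1 + x) ^ 2).im) {H : ℕ → ℂ}
    (hH : ∀ n, rowSum a x H n = x * rowSum a 1 H n + (1 - x)) (n : ℕ) :
    rowSum a x H n ≠ 0 ∧ H (n + 1) ≠ 0 := by
  have h0 : x ≠ 0 := fun h => hx (by rw [h, Complex.zero_im])
  have h1 : 1 + x ≠ 0 := fun h => hx (by simpa using congrArg Complex.im h)
  have h1' : 1 - x ≠ 0 := fun h => hx (by simpa using congrArg Complex.im h)
  have hV : (wordPair a (x / (1 + x) ^ 2) n).1 0 ≠ 0 ∧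
      ∑ i ∈ Finset.Ico 0 (n + 1), (a i : ℂ) * (wordPair a (x / (1 + x) ^ 2) n).1 i ≠ 0 := by
    rcases ht.lt_or_eq with ht | ht
    · exact ⟨(interlacedPairAt_wordPair ha ht n).ne_zero, sum_wordPair_ne_zero ha ht n⟩
    · have hp := div_one_add_sq_pos hx ht.symm
      exact ⟨(wordPair_zero_pos ha hp n).ne', (sum_wordPair_pos ha hp n).ne'⟩
  constructor
  · rw [(wordPair_eq_tailSum ha0 hx hH n).1]
    exact mul_ne_zero (pow_ne_zero n h1) hV.1
  · intro e
    have h := ((wordPair_eq_tailSum ha0 hx hH (n + 1)).2 (n + 1) (by omega) le_rfl).2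
    rw [tailSum_self, tailSum_self, e] at h
    have h := h.symm
    simp only [mul_zero, sub_zero] at h
    exact mul_ne_zero (mul_ne_zero h1' (pow_ne_zero _ h1))
      (mul_ne_zero (div_ne_zero h0 (pow_ne_zero 2 h1)) hV.2) h

/-! ## Chow polynomials and Möbius inversion -/

section MoebiusInversion

variable {P : Type*} [PartialOrder P] [LocallyFiniteOrder P] [DecidableEq P]

theorem intervalChowPoly_self (t : P) : intervalChowPoly t t = 1 := by
  rw [intervalChowPoly, if_pos rfl]

theorem intervalCharPoly_self (s : P) : intervalCharPoly s s = 1 := by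
  simp [intervalCharPoly]

/-- Multiplying the definition by x - 1 clears the reduced characteristic polynomials; moving
-H_{s,t} to the other side supplies the missing term w = s. -/
theorem X_mul_intervalChowPoly {s t : P} (h : s < t) :
    X * intervalChowPoly s t =
      ∑ w ∈ Finset.Icc s t, intervalCharPoly s w * intervalChowPoly w t := by
  have e : (X - C 1) * intervalChowPoly s t =
      ∑ w ∈ Finset.Ioc s t, intervalCharPoly s w * intervalChowPoly w t := by
    rw [intervalChowPoly, if_neg h.ne,
      Finset.sum_attach (Finset.Ioc s t) fun w => reducedCharPoly s w * intervalChowPoly w t,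
      Finset.mul_sum]
    refine Finset.sum_congr rfl fun w hw => ?_
    rw [← mul_assoc, mul_reducedCharPoly (Finset.mem_Ioc.1 hw).1]
  rw [← Finset.sum_Ioc_add_eq_sum_Icc h.le, ← e, intervalCharPoly_self, C_1]
  ring

theorem sum_Icc_Icc_comm {P M : Type*} [PartialOrder P] [LocallyFiniteOrder P] [AddCommMonoid M]
    (s t : P) (f : P → P → M) :
    ∑ u ∈ Finset.Icc s t, ∑ w ∈ Finset.Icc u t, f u w =
      ∑ w ∈ Finset.Icc s t, ∑ u ∈ Finset.Icc s w, f u w := by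
  refine Finset.sum_comm' fun u w => ?_
  simp only [Finset.mem_Icc]
  constructor
  · rintro ⟨⟨h1, _⟩, h3, h4⟩
    exact ⟨⟨h1, h3⟩, h1.trans h3, h4⟩
  · rintro ⟨⟨h1, h2⟩, _, h4⟩
    exact ⟨⟨h1, h2.trans h4⟩, h2, h4⟩

/-- The weighted sum of the Chow polynomials of the upper intervals of `s`. -/
noncomputable def weightedChowSum (s t : P) : ℤ[X] :=
  ∑ w ∈ Finset.Icc s t, X ^ (posetRank w - posetRank s) * intervalChowPoly w t

theorem sum_mu_mul_weightedChowSum (s t : P) :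
    ∑ u ∈ Finset.Icc s t, C (IncidenceAlgebra.mu ℤ s u) * weightedChowSum u t =
      ∑ w ∈ Finset.Icc s t, intervalCharPoly s w * intervalChowPoly w t := by
  simp only [weightedChowSum, intervalCharPoly, Finset.mul_sum, Finset.sum_mul]
  rw [sum_Icc_Icc_comm]
  simp only [mul_assoc]

/-- The Möbius transform of the weighted sums at u is x H_{u,t}, corrected by 1 - x at u = t.
Summing over all u in [s, t] inverts the transform and eliminates the Möbius function. -/
theorem weightedChowSum_eq {s t : P} (hst : s ≤ t) :
    weightedChowSum s t = X * ∑ w ∈ Finset.Icc s t, intervalChowPoly w t + (1 - X) := by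
  have hF : ∀ u ∈ Finset.Icc s t,
      ∑ v ∈ Finset.Icc u t, C (IncidenceAlgebra.mu ℤ u v) * weightedChowSum v t =
        X * intervalChowPoly u t + if u = t then 1 - X else 0 := by
    intro u hu
    rw [sum_mu_mul_weightedChowSum]
    split_ifs with h
    · subst h
      simp [intervalCharPoly_self, intervalChowPoly_self]
    · rw [← X_mul_intervalChowPoly (lt_of_le_of_ne (Finset.mem_Icc.1 hu).2 h), add_zero]
  have h1 := Finset.sum_congr rfl hF
  rw [sum_Icc_Icc_comm, Finset.sum_add_distrib, ← Finset.mul_sum, Finset.sum_ite_eq',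
    if_pos (Finset.right_mem_Icc.2 hst)] at h1
  rw [← h1]
  have h2 : ∀ v ∈ Finset.Icc s t,
      ∑ u ∈ Finset.Icc s v, C (IncidenceAlgebra.mu ℤ u v) * weightedChowSum v t =
        if s = v then weightedChowSum v t else 0 := by
    intro v hv
    rw [← Finset.sum_mul, ← map_sum, IncidenceAlgebra.sum_Icc_mu_left]
    split_ifs <;> simp
  rw [Finset.sum_congr rfl h2, Finset.sum_ite_eq, if_pos (Finset.left_mem_Icc.2 hst)]

end MoebiusInversion

/-! ## Enumeration of chains -/

section Chains

open Classical in
/-- The generating function of the chains in `T` by cardinality. -/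
noncomputable def chainSum {Q : Type*} [PartialOrder Q] (t : ℂ) (T : Finset Q) : ℂ :=
  ∑ σ ∈ T.powerset, if IsChain (· ≤ ·) (σ : Set Q) then t ^ σ.card else 0

open Classical in
theorem chainSum_insert {Q : Type*} [PartialOrder Q] (t : ℂ) {T : Finset Q} {m : Q} (hm : m ∉ T)
    (hmin : ∀ x ∈ T, ¬ x < m) :
    chainSum t (insert m T) = chainSum t T + t * chainSum t (T.filter (m < ·)) := by
  rw [chainSum, Finset.sum_powerset_insert hm, ← chainSum]
  congr 1
  rw [chainSum, Finset.mul_sum]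
  symm
  have hsub : (T.filter (m < ·)).powerset ⊆ T.powerset :=
    Finset.powerset_mono.2 (Finset.filter_subset _ _)
  rw [← Finset.sum_subset hsub (f := fun τ =>
    if IsChain (· ≤ ·) ((insert m τ : Finset Q) : Set Q) then t ^ (insert m τ).card else 0)]
  · refine Finset.sum_congr rfl fun τ hτ => ?_
    have hlt : ∀ x ∈ τ, m < x := fun x hx =>
      (Finset.mem_filter.1 (Finset.mem_powerset.1 hτ hx)).2
    have hmτ : m ∉ τ := fun h => lt_irrefl m (hlt m h)
    have e : IsChain (· ≤ ·) ((insert m τ : Finset Q) : Set Q) ↔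
        IsChain (· ≤ ·) (τ : Set Q) := by
      rw [Finset.coe_insert]
      exact ⟨fun h => h.mono (Set.subset_insert _ _),
        fun h => h.insert fun x hx _ => Or.inl (hlt x hx).le⟩
    rw [Finset.card_insert_of_notMem hmτ]
    simp only [e]
    split_ifs
    · ring
    · ring
  · intro τ hτ hτ'
    refine if_neg fun hc => hτ' (Finset.mem_powerset.2 fun x hx => ?_)
    have hxT := Finset.mem_powerset.1 hτ hx
    refine Finset.mem_filter.2 ⟨hxT, ?_⟩
    have hne : m ≠ x := fun e => hm (e ▸ hxT)
    rcases hc (Finset.mem_coe.2 (Finset.mem_insert_self m τ))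
      (Finset.mem_coe.2 (Finset.mem_insert_of_mem hx)) hne with h | h
    · exact lt_of_le_of_ne h hne
    · exact absurd (lt_of_le_of_ne h hne.symm) (hmin x hxT)

open Classical in
-- A nonempty chain is its least element w together with a chain above w. The induction removes a
-- minimal element of T, which lies above no other element and so leaves the other upper sets
-- unchanged.
theorem chainSum_eq {Q : Type*} [PartialOrder Q] (t : ℂ) (T : Finset Q) :
    chainSum t T = 1 + t * ∑ w ∈ T, chainSum t (T.filter (w < ·)) := by
  induction T using Finset.strongInduction with
  | H T ih =>
    rcases T.eq_empty_or_nonempty with rfl | hT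
    · simp [chainSum]
    · obtain ⟨m, hmT, hm⟩ := T.exists_minimal hT
      have hmin : ∀ x ∈ T.erase m, ¬ x < m := fun x hx h =>
        absurd (hm (Finset.mem_of_mem_erase hx) h.le) (not_le_of_gt h)
      have h1 := chainSum_insert t (Finset.notMem_erase m T) hmin
      rw [Finset.insert_erase hmT] at h1
      have hf : ∀ w ∈ T, T.filter (w < ·) = (T.erase m).filter (w < ·) := by
        intro w hw
        ext x
        simp only [Finset.mem_filter, Finset.mem_erase]
        refine ⟨fun h => ⟨⟨?_, h.1⟩, h.2⟩, fun h => ⟨h.1.2, h.2⟩⟩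
        rintro rfl
        exact absurd (hm hw h.2.le) (not_le_of_gt h.2)
      rw [h1, ih _ (Finset.erase_ssubset hmT), ← Finset.add_sum_erase T _ hmT, ← hf m hmT,
        Finset.sum_congr rfl fun w hw =>
          congrArg (chainSum t) (hf w (Finset.mem_of_mem_erase hw)).symm]
      ring

theorem sum_faceFinset_orderComplex {Q : Type*} [PartialOrder Q] [Fintype Q] (t : ℂ) :
    ∑ σ ∈ faceFinset (orderComplex Q), t ^ σ.card = chainSum t (Finset.univ : Finset Q) := by
  classical
  rw [chainSum, ← Finset.sum_filter]
  refine Finset.sum_congr ?_ fun _ _ => rfl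
  ext σ
  simp only [faceFinset, Set.Finite.mem_toFinset, Set.mem_insert_iff, Finset.mem_filter,
    Finset.mem_powerset, Finset.subset_univ, true_and]
  constructor
  · rintro (rfl | h)
    · simp
    · exact h.2
  · intro h
    rcases σ.eq_empty_or_nonempty with rfl | hσ
    · exact Or.inl rfl
    · exact Or.inr ⟨hσ, h⟩

/-- A solution of the recursion for chains enumerates the faces of the order complex. -/
theorem sum_faceFinset_of_recursion {Q : Type*} [PartialOrder Q] [Fintype Q]
    [DecidableRel (α := Q) (· < ·)] (t : ℂ) {K : Q → ℂ}
    (hK : ∀ w, K w = 1 + t * ∑ v ∈ Finset.univ.filter (w < ·), K v) :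
    ∑ σ ∈ faceFinset (orderComplex Q), t ^ σ.card = 1 + t * ∑ w, K w := by
  classical
  have h : ∀ w : Q, chainSum t (Finset.univ.filter (w < ·)) = K w := by
    intro w
    induction w using WellFoundedGT.induction with
    | ind w ih =>
      rw [hK, chainSum_eq]
      congr 2
      refine Finset.sum_congr (by congr) fun v hv => ?_
      have hv : w < v := by simpa using hv
      rw [← ih v hv]
      congr 1
      ext x
      simpa using fun hx : v < x => hv.trans hx
  rw [sum_faceFinset_orderComplex, chainSum_eq]
  congr 2
  refine Finset.sum_congr rfl fun w _ => ?_
  rw [← h w]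
  congr

theorem aeval_hPolynomial {V : Type*} [Finite V] (K : AbstractSimplicialComplex V) {y : ℂ}
    (hy : 1 - y ≠ 0) :
    aeval y (hPolynomial K) =
      (1 - y) ^ maxFaceCard K * ∑ σ ∈ faceFinset K, (y / (1 - y)) ^ σ.card := by
  classical
  have hmaps : ∀ σ ∈ faceFinset K, σ.card ∈ Finset.range (maxFaceCard K + 1) := fun σ hσ =>
    Finset.mem_range.2 (Nat.lt_succ_iff.2 (Finset.le_sup (f := Finset.card) hσ))
  rw [hPolynomial, ← Finset.sum_fiberwise_of_maps_to hmaps, Finset.mul_sum, map_sum]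
  refine Finset.sum_congr rfl fun i hi => ?_
  have hi : i ≤ maxFaceCard K := Nat.lt_succ_iff.1 (Finset.mem_range.1 hi)
  rw [Finset.sum_congr rfl fun σ hσ => by rw [(Finset.mem_filter.1 hσ).2], Finset.sum_const,
    fNumber, nsmul_eq_mul]
  simp only [map_mul, map_pow, map_sub, map_one, aeval_X]
  have e : (1 - y) ^ maxFaceCard K = (1 - y) ^ (maxFaceCard K - i) * (1 - y) ^ i := by
    rw [← pow_add, Nat.sub_add_cancel hi]
  rw [e, div_pow]
  field_simp
  simp [mul_comm]

end Chains

/-! ## Dowling geometries as kernels of maps to free pointed `G`-sets -/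

namespace GPrepartition

variable {n : ℕ} {G : Type*} [Group G]

/-- `i` and `j` lie in the same block, and the label of `j` is `g` times the label of `i` if this
block is nonzero. -/
def Rel (a : GPrepartition n G) (i j : Fin (n + 1)) (g : G) : Prop :=
  a.part i j ∧ ∀ (hi : ¬ a.part i 0) (hj : ¬ a.part j 0), a.label ⟨j, hj⟩ = a.label ⟨i, hi⟩ * g

theorem rel_self_zero {a : GPrepartition n G} {i : Fin (n + 1)} {g : G} :
    a.Rel i 0 g ↔ a.part i 0 :=
  ⟨fun h => h.1, fun h => ⟨h, fun hi => absurd h hi⟩⟩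

theorem exists_rel_iff {a : GPrepartition n G} {i j : Fin (n + 1)} :
    (∃ g, a.Rel i j g) ↔ a.part i j := by
  refine ⟨fun ⟨_, h⟩ => h.1, fun h => ?_⟩
  by_cases hi : a.part i 0
  · exact ⟨1, h, fun hi' => absurd hi hi'⟩
  · have hj : ¬ a.part j 0 := fun hj => hi (a.part.trans' h hj)
    exact ⟨(a.label ⟨i, hi⟩)⁻¹ * a.label ⟨j, hj⟩, h, fun _ _ => (mul_inv_cancel_left _ _).symm⟩

theorem Rel.of_below {a b : GPrepartition n G} (h : Below a b) {i j : Fin (n + 1)} {g : G}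
    (hr : a.Rel i j g) : b.Rel i j g := by
  refine ⟨part_le_of_below h hr.1, fun hi hj => ?_⟩
  obtain ⟨ai, _, ei⟩ := h i hi
  obtain ⟨aj, _, ej⟩ := h j hj
  rw [← ei, ← ej]
  exact hr.2 ai aj

theorem Rel.of_equivalent {a b : GPrepartition n G} (h : Equivalent a b) {i j : Fin (n + 1)}
    {g : G} (hr : a.Rel i j g) : b.Rel i j g := by
  obtain ⟨p, l⟩ := a
  obtain ⟨q, m⟩ := b
  obtain ⟨hp, h⟩ := h
  dsimp only at hp h
  subst hp
  refine ⟨hr.1, fun hi hj => ?_⟩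
  obtain ⟨c, hc⟩ := h i hi
  have e := hr.2 hi hj
  dsimp only at e hi hj ⊢
  rw [hc i hi hi (p.refl' i), hc j hj hj hr.1, mul_assoc] at e
  exact mul_left_cancel e

/-- Relabel a by the labels of b off the zero block of b. On an a-block there, the relations force
equal ratios of labels, so the two labelings differ by a left factor. -/
theorem exists_equivalent_below {a b : GPrepartition n G}
    (h : ∀ i j g, a.Rel i j g → b.Rel i j g) : ∃ a', Equivalent a' a ∧ Below a' b := by
  classical
  have hpart : ∀ {i j}, a.part i j → b.part i j := fun hij => by
    obtain ⟨g, hg⟩ := exists_rel_iff.2 hij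
    exact (h _ _ g hg).1
  refine ⟨⟨a.part, fun i => if hi : b.part i.1 0 then a.label i else b.label ⟨i.1, hi⟩⟩,
    ⟨rfl, fun i hi => ?_⟩, fun i hi => ⟨fun ha => hi (hpart ha), fun j hj => hpart hj, dif_neg hi⟩⟩
  dsimp only at hi ⊢
  by_cases hbi : b.part i 0
  · refine ⟨1, fun j hj _ hij => ?_⟩
    rw [dif_pos (b.part.trans' (b.part.symm' (hpart hij)) hbi), one_mul]
  · refine ⟨b.label ⟨i, hbi⟩ * (a.label ⟨i, hi⟩)⁻¹, fun j hj _ hij => ?_⟩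
    have hbj : ¬ b.part j 0 := fun hbj => hbi (b.part.trans' (hpart hij) hbj)
    obtain ⟨g, hg⟩ := exists_rel_iff (a := a).2 hij
    rw [dif_neg hbj, hg.2 hi hj, (h i j g hg).2 hbi hbj, mul_assoc, inv_mul_cancel_left]

/-- The number of nonzero blocks. -/
noncomputable def blockCount (a : GPrepartition n G) : ℕ :=
  Nat.card {q : Quotient a.part // q ≠ Quotient.mk _ 0}

end GPrepartition

namespace DowlingGeometry

open GPrepartition

variable {n : ℕ} {G : Type*} [Group G]

/-- The `G`-equivariant equivalence relation that belongs to an element of `Q_n(G)`. -/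
def Rel (P : DowlingGeometry n G) (i j : Fin (n + 1)) (g : G) : Prop :=
  (Quotient.out P : GPrepartition n G).Rel i j g

theorem rel_mk {a : GPrepartition n G} {i j : Fin (n + 1)} {g : G} :
    Rel (Quotient.mk _ a : DowlingGeometry n G) i j g ↔ a.Rel i j g := by
  have h : Equivalent (Quotient.out (Quotient.mk (GPrepartition.setoid n G) a)) a :=
    Quotient.mk_out a
  exact ⟨GPrepartition.Rel.of_equivalent h, GPrepartition.Rel.of_equivalent (equivalent_symm h)⟩

/-- The ternary relation is invariant under equivalence, so order and equality in Q_n(G) can be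
tested without choosing representatives. -/
theorem le_iff_rel {P Q : DowlingGeometry n G} :
    P ≤ Q ↔ ∀ i j g, P.Rel i j g → Q.Rel i j g := by
  constructor
  · rintro ⟨a, b, rfl, rfl, h⟩ i j g hr
    rw [rel_mk] at hr ⊢
    exact hr.of_below h
  · obtain ⟨a, rfl⟩ := Quotient.exists_rep P
    obtain ⟨b, rfl⟩ := Quotient.exists_rep Q
    intro h
    obtain ⟨a', ha', hb⟩ := exists_equivalent_below (a := a) (b := b) fun i j g hr =>
      rel_mk.1 (h i j g (rel_mk.2 hr))
    exact ⟨a', b, Quotient.sound ha', rfl, hb⟩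

theorem ext_rel {P Q : DowlingGeometry n G} (h : ∀ i j g, P.Rel i j g ↔ Q.Rel i j g) : P = Q :=
  le_antisymm (le_iff_rel.2 fun i j g => (h i j g).1) (le_iff_rel.2 fun i j g => (h i j g).2)

/-- The corank: the number of nonzero blocks. -/
noncomputable def corank (P : DowlingGeometry n G) : ℕ :=
  blockCount (Quotient.out P : GPrepartition n G)

theorem corank_mk (a : GPrepartition n G) :
    corank (Quotient.mk _ a : DowlingGeometry n G) = blockCount a := by
  have h : Equivalent (Quotient.out (Quotient.mk (GPrepartition.setoid n G) a)) a :=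
    Quotient.mk_out a
  change blockCount (Quotient.out (Quotient.mk (GPrepartition.setoid n G) a)) = _
  rw [blockCount, blockCount, h.1]

end DowlingGeometry

/-- A right action of `G` on a pointed set that is free off the base point. -/
structure PointedAction (T : Type*) (G : Type*) [Group G] where
  act : T → G → T
  zero : T
  act_one : ∀ t, act t 1 = t
  act_act : ∀ t g h, act (act t g) h = act t (g * h)
  zero_act : ∀ g, act zero g = zero
  free : ∀ t g, act t g = t → t = zero ∨ g = 1

namespace PointedAction

variable {T G : Type*} [Group G] (A : PointedAction T G)

theorem act_cancel {t : T} (ht : t ≠ A.zero) {g h : G} (e : A.act t g = A.act t h) : g = h := by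
  have e1 := congrArg (fun s => A.act s h⁻¹) e
  simp only [A.act_act, mul_inv_cancel, A.act_one] at e1
  exact mul_inv_eq_one.1 ((A.free _ _ e1).resolve_left ht)

theorem act_inj {s t : T} {g : G} (e : A.act s g = A.act t g) : s = t := by
  have e1 := congrArg (fun s => A.act s g⁻¹) e
  simpa only [A.act_act, mul_inv_cancel, A.act_one] using e1

theorem act_eq_zero_iff {t : T} {g : G} : A.act t g = A.zero ↔ t = A.zero := by
  refine ⟨fun h => ?_, fun h => by rw [h, A.zero_act]⟩
  rw [← A.zero_act g] at h
  exact A.act_inj h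

theorem eq_act_symm {s t : T} {g : G} (e : s = A.act t g) : t = A.act s g⁻¹ := by
  rw [e, A.act_act, mul_inv_cancel, A.act_one]

/-- The free pointed `G`-set with orbits indexed by `V`. -/
def freeAction (V G : Type*) [Group G] : PointedAction (Option (V × G)) G where
  act t g := t.map fun p => (p.1, p.2 * g)
  zero := none
  act_one t := by cases t <;> simp
  act_act t g h := by cases t <;> simp [mul_assoc]
  zero_act _ := rfl
  free t g h := by
    cases t with
    | none => exact Or.inl rfl
    | some p =>
      right
      simpa [Prod.ext_iff] using h

variable {n : ℕ}

/-- The partition into the fibers over orbits of a map to a pointed `G`-set. -/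
def kerPart (f : Fin (n + 1) → T) : Setoid (Fin (n + 1)) where
  r i j := ∃ g, f j = A.act (f i) g
  iseqv := ⟨fun i => ⟨1, (A.act_one _).symm⟩, fun ⟨g, h⟩ => ⟨g⁻¹, A.eq_act_symm h⟩,
    fun ⟨g, h⟩ ⟨g', h'⟩ => ⟨g * g', by rw [h', h, A.act_act]⟩⟩

theorem kerPart_iff {f : Fin (n + 1) → T} {i j : Fin (n + 1)} :
    A.kerPart f i j ↔ ∃ g, f j = A.act (f i) g := Iff.rfl

theorem kerPart_zero_iff {f : Fin (n + 1) → T} (h0 : f 0 = A.zero) {i : Fin (n + 1)} :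
    A.kerPart f i 0 ↔ f i = A.zero := by
  rw [kerPart_iff, h0]
  refine ⟨fun ⟨g, h⟩ => A.act_eq_zero_iff.1 h.symm, fun h => ⟨1, by rw [h, A.zero_act]⟩⟩

theorem exists_act_out (f : Fin (n + 1) → T) (i : Fin (n + 1)) :
    ∃ g, f i = A.act (f (Quotient.out (Quotient.mk (A.kerPart f) i))) g :=
  Quotient.mk_out (s := A.kerPart f) i

/-- The `G`-prepartition of a map to a pointed `G`-set. -/
noncomputable def kerPrepartition (f : Fin (n + 1) → T) : GPrepartition n G where
  part := A.kerPart f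
  label i := (A.exists_act_out f i.1).choose

/-- Labels record the translation from the chosen representative of a block. Freeness off the base
point makes them unique on nonzero blocks. -/
theorem kerPrepartition_rel {f : Fin (n + 1) → T} (h0 : f 0 = A.zero) {i j : Fin (n + 1)}
    {g : G} : (A.kerPrepartition f).Rel i j g ↔ f j = A.act (f i) g := by
  have hlab : ∀ (k : Fin (n + 1)) (hk : ¬ (A.kerPrepartition f).part k 0),
      f k = A.act (f (Quotient.out (Quotient.mk (A.kerPart f) k)))
        ((A.kerPrepartition f).label ⟨k, hk⟩) := fun k _ => (A.exists_act_out f k).choose_spec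
  have hz : ∀ k, (A.kerPrepartition f).part k 0 ↔ f k = A.zero := fun k => A.kerPart_zero_iff h0
  constructor
  · rintro ⟨hij, hl⟩
    by_cases hi : (A.kerPrepartition f).part i 0
    · have hj : (A.kerPrepartition f).part j 0 :=
        (A.kerPrepartition f).part.trans' ((A.kerPrepartition f).part.symm' hij) hi
      rw [(hz i).1 hi, (hz j).1 hj, A.zero_act]
    · have hj : ¬ (A.kerPrepartition f).part j 0 := fun hj =>
        hi ((A.kerPrepartition f).part.trans' hij hj)
      have e : Quotient.mk (A.kerPart f) i = Quotient.mk (A.kerPart f) j := Quotient.sound hij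
      rw [hlab j hj, hl hi hj, ← A.act_act, ← e, ← hlab i hi]
  · intro h
    have hij : A.kerPart f i j := ⟨g, h⟩
    refine ⟨hij, fun hi hj => ?_⟩
    have e : Quotient.mk (A.kerPart f) i = Quotient.mk (A.kerPart f) j := Quotient.sound hij
    have hr : f (Quotient.out (Quotient.mk (A.kerPart f) i)) ≠ A.zero := by
      intro h'
      apply hi
      rw [hz, hlab i hi, h', A.zero_act]
    apply A.act_cancel hr
    rw [← A.act_act, ← hlab i hi, ← h, e]
    exact (hlab j hj).symm

theorem exists_ker {f : Fin (n + 1) → T} (h0 : f 0 = A.zero) :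
    ∃ P : DowlingGeometry n G, ∀ i j g, P.Rel i j g ↔ f j = A.act (f i) g :=
  ⟨Quotient.mk _ (A.kerPrepartition f), fun _ _ _ =>
    DowlingGeometry.rel_mk.trans (A.kerPrepartition_rel h0)⟩

/-- The maps to a pointed `G`-set that are compatible with a `G`-prepartition. -/
def Compatible (a : GPrepartition n G) (f : Fin (n + 1) → T) : Prop :=
  f 0 = A.zero ∧ ∀ i j g, a.Rel i j g → f j = A.act (f i) g

theorem Compatible.eq_zero {A : PointedAction T G} {a : GPrepartition n G} {f : Fin (n + 1) → T}
    (hf : A.Compatible a f) {i : Fin (n + 1)} (hi : a.part i 0) : f i = A.zero := by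
  have h := hf.2 i 0 1 (GPrepartition.rel_self_zero.2 hi)
  rw [hf.1, A.act_one] at h
  exact h.symm

theorem mk_ne_of_not {p : Setoid (Fin (n + 1))} {i : Fin (n + 1)} (hi : ¬ p i 0) :
    Quotient.mk p i ≠ Quotient.mk p 0 := fun h => hi (Quotient.exact h)

theorem not_of_ne {p : Setoid (Fin (n + 1))} (q : {q : Quotient p // q ≠ Quotient.mk _ 0}) :
    ¬ p (Quotient.out q.1) 0 := fun h => q.2 (by
  rw [← Quotient.out_eq q.1]
  exact Quotient.sound h)

open Classical in
/-- Extension of a function on the nonzero blocks to a compatible map. -/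
noncomputable def extend (a : GPrepartition n G)
    (F : {q : Quotient a.part // q ≠ Quotient.mk _ 0} → T) (i : Fin (n + 1)) : T :=
  if hi : a.part i 0 then A.zero
  else A.act (F ⟨Quotient.mk _ i, mk_ne_of_not hi⟩) (a.label ⟨i, hi⟩)

theorem compatible_extend (a : GPrepartition n G)
    (F : {q : Quotient a.part // q ≠ Quotient.mk _ 0} → T) : A.Compatible a (A.extend a F) := by
  refine ⟨dif_pos (a.part.refl' 0), fun i j g h => ?_⟩
  by_cases hi : a.part i 0
  · have hj : a.part j 0 := a.part.trans' (a.part.symm' h.1) hi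
    rw [extend, extend, dif_pos hi, dif_pos hj, A.zero_act]
  · have hj : ¬ a.part j 0 := fun hj => hi (a.part.trans' h.1 hj)
    have e : Quotient.mk a.part i = Quotient.mk a.part j := Quotient.sound h.1
    rw [extend, extend, dif_neg hi, dif_neg hj, h.2 hi hj, A.act_act]
    simp only [e]

/-- Compatible maps are determined by a value for each nonzero block. -/
noncomputable def compatibleEquiv (a : GPrepartition n G) :
    ({q : Quotient a.part // q ≠ Quotient.mk _ 0} → T) ≃
      {f : Fin (n + 1) → T // A.Compatible a f} where
  toFun F := ⟨A.extend a F, A.compatible_extend a F⟩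
  invFun f q := A.act (f.1 (Quotient.out q.1)) (a.label ⟨Quotient.out q.1, not_of_ne q⟩)⁻¹
  left_inv F := by
    funext q
    simp only [extend]
    rw [dif_neg (not_of_ne q), A.act_act, mul_inv_cancel, A.act_one]
    congr 1
    exact Subtype.ext (Quotient.out_eq q.1)
  right_inv f := by
    apply Subtype.ext
    funext i
    simp only [extend]
    split_ifs with hi
    · exact (f.2.eq_zero hi).symm
    · have hr : a.part (Quotient.out (Quotient.mk a.part i)) i := Quotient.mk_out i
      rw [A.act_act]
      exact (f.2.2 _ _ _ ⟨hr, fun _ _ => (mul_inv_cancel_left _ _).symm⟩).symm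

theorem card_compatible [Finite T] (a : GPrepartition n G) :
    Nat.card {f : Fin (n + 1) → T // A.Compatible a f} = Nat.card T ^ a.blockCount := by
  rw [← Nat.card_congr (A.compatibleEquiv a), Nat.card_fun, GPrepartition.blockCount]

/-- The maps whose kernel is the given `G`-prepartition. -/
def HasKer (a : GPrepartition n G) (f : Fin (n + 1) → T) : Prop :=
  f 0 = A.zero ∧ ∀ i j g, a.Rel i j g ↔ f j = A.act (f i) g

theorem HasKer.compatible {A : PointedAction T G} {a : GPrepartition n G} {f : Fin (n + 1) → T}
    (h : A.HasKer a f) : A.Compatible a f := ⟨h.1, fun i j g => (h.2 i j g).1⟩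

/-- The kernel of a compatible map can exceed a in two ways only: a nonzero block is sent to the
base point, or two nonzero blocks are sent to the same orbit. -/
theorem hasKer_extend_iff (a : GPrepartition n G)
    (F : {q : Quotient a.part // q ≠ Quotient.mk _ 0} → T) :
    A.HasKer a (A.extend a F) ↔
      (∀ q, F q ≠ A.zero) ∧ ∀ q r g, F r = A.act (F q) g → q = r := by
  have hout : ∀ q : {q : Quotient a.part // q ≠ Quotient.mk _ 0},
      A.extend a F (Quotient.out q.1) =
        A.act (F q) (a.label ⟨Quotient.out q.1, not_of_ne q⟩) := fun q => by
    rw [extend, dif_neg (not_of_ne q)]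
    congr 2
    exact Subtype.ext (Quotient.out_eq q.1)
  constructor
  · intro h
    constructor
    · intro q hq
      refine not_of_ne q (GPrepartition.rel_self_zero.1 ((h.2 (Quotient.out q.1) 0 1).2 ?_))
      rw [h.1, hout, hq, A.zero_act, A.zero_act]
    · intro q r g e
      have h1 : a.Rel (Quotient.out q.1) (Quotient.out r.1)
          ((a.label ⟨Quotient.out q.1, not_of_ne q⟩)⁻¹ *
            (g * a.label ⟨Quotient.out r.1, not_of_ne r⟩)) := by
        rw [h.2, hout, hout, e, A.act_act, A.act_act, mul_inv_cancel_left]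
      apply Subtype.ext
      rw [← Quotient.out_eq q.1, ← Quotient.out_eq r.1]
      exact Quotient.sound h1.1
  · rintro ⟨h1, h2⟩
    refine ⟨(A.compatible_extend a F).1, fun i j g =>
      ⟨(A.compatible_extend a F).2 i j g, fun h => ?_⟩⟩
    have hz : ∀ k, A.extend a F k = A.zero ↔ a.part k 0 := fun k => by
      refine ⟨fun hk => ?_, (A.compatible_extend a F).eq_zero⟩
      by_contra hk'
      rw [extend, dif_neg hk', A.act_eq_zero_iff] at hk
      exact h1 _ hk
    by_cases hi : a.part i 0
    · rw [(hz i).2 hi, A.zero_act, hz] at h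
      exact ⟨a.part.trans' hi (a.part.symm' h), fun hi' => absurd hi hi'⟩
    · have hj : ¬ a.part j 0 := fun hj => by
        rw [(hz j).2 hj] at h
        exact hi ((hz i).1 (A.act_eq_zero_iff.1 h.symm))
      rw [extend, extend, dif_neg hi, dif_neg hj, A.act_act] at h
      have h' := A.eq_act_symm h
      rw [A.act_act] at h'
      have e := h2 _ _ _ h'
      refine ⟨a.part.symm' (Quotient.exact (congrArg Subtype.val e)), fun _ _ => ?_⟩
      rw [← e] at h
      exact A.act_cancel (h1 _) h

/-- Maps from blocks to distinct nonzero orbits of a free pointed `G`-set. -/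
noncomputable def freeEmbeddingEquiv (B V G : Type*) [Group G] :
    (B ↪ V) × (B → G) ≃ {F : B → Option (V × G) //
      (∀ q, F q ≠ (freeAction V G).zero) ∧ ∀ q r g, F r = (freeAction V G).act (F q) g → q = r} :=
  Equiv.ofBijective
    (fun p => ⟨fun q => some (p.1 q, p.2 q), fun _ => Option.some_ne_none _, fun q r g h =>
      p.1.injective (congrArg Prod.fst (Option.some.inj h)).symm⟩) (by
    constructor
    · rintro ⟨e, u⟩ ⟨e', u'⟩ h
      have h' : ∀ q, (e q, u q) = (e' q, u' q) := fun q =>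
        Option.some.inj (congrFun (congrArg Subtype.val h) q)
      refine Prod.ext (DFunLike.ext _ _ fun q => congrArg Prod.fst (h' q))
        (funext fun q => congrArg Prod.snd (h' q))
    · rintro ⟨F, h1, h2⟩
      have h3 : ∀ q, ∃ p, F q = some p := fun q => Option.ne_none_iff_exists'.1 (h1 q)
      choose p hp using h3
      refine ⟨(⟨fun q => (p q).1, fun q r hqr => h2 q r ((p q).2⁻¹ * (p r).2) ?_⟩,
        fun q => (p q).2), Subtype.ext (funext fun q => (hp q).symm)⟩
      dsimp only at hqr
      simp only [hp, freeAction, Option.map_some, mul_inv_cancel_left, hqr])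

/-- An injective choice of orbits for the nonzero blocks, and a group element for each block. -/
theorem card_hasKer [Finite G] (k : ℕ) (a : GPrepartition n G) :
    Nat.card {f : Fin (n + 1) → Option (Fin k × G) // (freeAction (Fin k) G).HasKer a f} =
      k.descFactorial a.blockCount * Nat.card G ^ a.blockCount := by
  classical
  have : Fintype {q : Quotient a.part // q ≠ Quotient.mk _ 0} := Fintype.ofFinite _
  let e1 := (Equiv.subtypeEquivRight fun F => (freeAction (Fin k) G).hasKer_extend_iff a F)
  let e2 : {F // (freeAction (Fin k) G).HasKer a ((freeAction (Fin k) G).extend a F)} ≃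
      {f // (freeAction (Fin k) G).HasKer a f} :=
    ((freeAction (Fin k) G).compatibleEquiv a).subtypeEquiv
      (q := fun f => (freeAction (Fin k) G).HasKer a f.1) (fun F => Iff.rfl) |>.trans
      (Equiv.subtypeSubtypeEquivSubtype fun h => h.compatible)
  rw [← Nat.card_congr e2, Nat.card_congr e1, ← Nat.card_congr (freeEmbeddingEquiv _ _ _),
    Nat.card_prod, Nat.card_fun, GPrepartition.blockCount, Nat.card_eq_fintype_card (α := _ ↪ _),
    Fintype.card_embedding_eq, Fintype.card_fin, Nat.card_eq_fintype_card
      (α := {q : Quotient a.part // q ≠ Quotient.mk _ 0})]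

theorem exists_hasKer (a : GPrepartition n G) :
    ∃ f : Fin (n + 1) → Option (Quotient a.part × G),
      (freeAction (Quotient a.part) G).HasKer a f :=
  ⟨_, ((freeAction (Quotient a.part) G).hasKer_extend_iff a fun q => some (q.1, 1)).2
    ⟨fun _ => Option.some_ne_none _, fun _ _ _ h =>
      Subtype.ext (congrArg Prod.fst (Option.some.inj h)).symm⟩⟩

end PointedAction

/-! ## Whitney numbers and rank of Dowling geometries -/

/-- Expansion of a power of 1 + mk in the basis m^j (k)_j. Multiplication by 1 + mk sends the j-th
basis element to the next one plus 1 + mj times itself, which is the recursion of the triangle. -/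
theorem sum_triangle_mul_descFactorial (m k n : ℕ) :
    ∑ j ∈ Finset.range (n + 1), triangle (fun i => 1 + m * i) n j *
      (k.descFactorial j * m ^ j) = (1 + m * k) ^ n := by
  induction n with
  | zero => simp [triangle]
  | succ n ih =>
    have h1 : ∀ j, (1 + m * k) * (k.descFactorial j * m ^ j) =
        k.descFactorial (j + 1) * m ^ (j + 1) +
          (1 + m * j) * (k.descFactorial j * m ^ j) := by
      intro j
      rw [Nat.descFactorial_succ]
      rcases le_or_gt j k with h | h
      · obtain ⟨d, rfl⟩ := Nat.exists_eq_add_of_le h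
        rw [Nat.add_sub_cancel_left]
        ring
      · rw [Nat.descFactorial_eq_zero_iff_lt.2 h]
        simp
    have h2 : ∑ j ∈ Finset.range (n + 1), triangle (fun i => 1 + m * i) n j *
        ((1 + m * j) * (k.descFactorial j * m ^ j)) =
        ∑ j ∈ Finset.range (n + 1), (1 + m * (j + 1)) *
          triangle (fun i => 1 + m * i) n (j + 1) * (k.descFactorial (j + 1) * m ^ (j + 1)) +
        triangle (fun i => 1 + m * i) n 0 * (k.descFactorial 0 * m ^ 0) := by
      have h := Finset.sum_range_succ' (fun j => triangle (fun i => 1 + m * i) n j *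
        ((1 + m * j) * (k.descFactorial j * m ^ j))) (n + 1)
      rw [Finset.sum_range_succ, triangle_eq_zero _ (Nat.lt_succ_self n), zero_mul, add_zero] at h
      rw [h]
      congr 1
      exact Finset.sum_congr rfl fun j _ => by ring
    rw [pow_succ', ← ih, Finset.mul_sum, Finset.sum_range_succ' _ (n + 1)]
    have h3 : ∀ j, (1 + m * k) * (triangle (fun i => 1 + m * i) n j *
        (k.descFactorial j * m ^ j)) = triangle (fun i => 1 + m * i) n j *
          (k.descFactorial (j + 1) * m ^ (j + 1)) + triangle (fun i => 1 + m * i) n j *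
        ((1 + m * j) * (k.descFactorial j * m ^ j)) := fun j => by
      rw [mul_left_comm, h1, mul_add]
    rw [Finset.sum_congr rfl fun j _ => h3 j, Finset.sum_add_distrib, h2, ← add_assoc,
      ← Finset.sum_add_distrib]
    congr 1
    · refine Finset.sum_congr rfl fun j _ => ?_
      rw [triangle_succ_succ]
      ring
    · rw [triangle_succ_zero, mul_zero, add_zero, one_mul]

/-- Coefficients with respect to falling factorials are determined by the values. -/
theorem eq_of_sum_descFactorial_eq {m : ℕ} (hm : 0 < m) {L : ℕ} {N M : ℕ → ℕ}
    (h : ∀ k : ℕ, ∑ j ∈ Finset.range L, N j * (k.descFactorial j * m ^ j) =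
      ∑ j ∈ Finset.range L, M j * (k.descFactorial j * m ^ j)) :
    ∀ j < L, N j = M j := by
  intro j
  induction j using Nat.strong_induction_on with
  | _ j ih =>
    intro hj
    -- At k = j the terms beyond j vanish and the coefficient of the j-th one is j! m^j, so the
    -- system is triangular.
    have hs : ∀ K : ℕ → ℕ, ∑ i ∈ Finset.range L, K i * (j.descFactorial i * m ^ i) =
        ∑ i ∈ Finset.range j, K i * (j.descFactorial i * m ^ i) +
          K j * (j.descFactorial j * m ^ j) := fun K => by
      rw [← Finset.sum_range_succ]
      symm
      refine Finset.sum_subset (Finset.range_subset_range.2 hj) fun i _ hi => ?_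
      rw [Nat.descFactorial_eq_zero_iff_lt.2 (by simpa using hi), zero_mul, mul_zero]
    have h1 := h j
    rw [hs, hs, Finset.sum_congr rfl fun i hi => by
      rw [ih i (Finset.mem_range.1 hi) ((Finset.mem_range.1 hi).trans hj)]] at h1
    have h2 := Nat.add_left_cancel h1
    refine Nat.eq_of_mul_eq_mul_right ?_ h2
    rw [Nat.descFactorial_self]
    positivity

namespace DowlingGeometry

open PointedAction

variable {n : ℕ} {G : Type*} [Group G]

theorem card_orbits (k : ℕ) (G : Type*) [Finite G] : Nat.card (Option (Fin k × G)) = 1 + Nat.card G * k := by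
  rw [Finite.card_option, Nat.card_prod, Nat.card_fin]
  ring

/-- Counting the maps to a free pointed `G`-set by their kernels. -/
theorem sum_descFactorial_corank [Finite G] (s : DowlingGeometry n G) (k : ℕ) :
    ∑ w ∈ Finset.Icc s ⊤, k.descFactorial w.corank * Nat.card G ^ w.corank =
      (1 + Nat.card G * k) ^ s.corank := by
  classical
  have : Fintype G := Fintype.ofFinite G
  let A := freeAction (Fin k) G
  have hker : ∀ f : Fin (n + 1) → Option (Fin k × G), f 0 = none →
      ∃ w : DowlingGeometry n G, A.HasKer w.out f := fun f hf => by
    obtain ⟨w, hw⟩ := A.exists_ker (f := f) hf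
    exact ⟨w, hf, hw⟩
  -- The default `⊥` is never used, since compatible maps send 0 to the base point.
  let ker : (Fin (n + 1) → Option (Fin k × G)) → DowlingGeometry n G := fun f =>
    if hf : f 0 = none then (hker f hf).choose else ⊥
  have hker' : ∀ f, f 0 = none → A.HasKer (ker f).out f := fun f hf => by
    simp only [ker, dif_pos hf]
    exact (hker f hf).choose_spec
  have huniq : ∀ f (w : DowlingGeometry n G), A.HasKer w.out f → ker f = w := fun f w h =>
    ext_rel fun i j g => ((hker' f h.1).2 i j g).trans (h.2 i j g).symm
  have hc : ∀ w : DowlingGeometry n G, k.descFactorial w.corank * Nat.card G ^ w.corank =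
      (Finset.univ.filter fun f => A.HasKer w.out f).card := fun w => by
    rw [← Fintype.card_subtype, ← Nat.card_eq_fintype_card]
    exact (card_hasKer k _).symm
  have hs : (1 + Nat.card G * k) ^ s.corank =
      (Finset.univ.filter fun f => A.Compatible s.out f).card := by
    rw [← Fintype.card_subtype, ← Nat.card_eq_fintype_card, A.card_compatible, card_orbits _ G]
    rfl
  have hmaps : ∀ f ∈ Finset.univ.filter fun f => A.Compatible s.out f,
      ker f ∈ Finset.Icc s ⊤ := fun f hf => by
    have hf := (Finset.mem_filter.1 hf).2
    refine Finset.mem_Icc.2 ⟨le_iff_rel.2 fun i j g h => ?_, le_top⟩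
    exact ((hker' f hf.1).2 i j g).2 (hf.2 i j g h)
  rw [hs, Finset.card_eq_sum_card_fiberwise hmaps]
  refine Finset.sum_congr rfl fun w hw => ?_
  rw [hc]
  congr 1
  ext f
  simp only [Finset.mem_filter, Finset.mem_univ, true_and]
  constructor
  · intro h
    exact ⟨⟨h.1, fun i j g hr => (h.2 i j g).1 (le_iff_rel.1 (Finset.mem_Icc.1 hw).1 i j g hr)⟩,
      huniq f w h⟩
  · rintro ⟨h, rfl⟩
    exact hker' f h.1

/-- The number of elements of given corank above an element. -/
theorem card_filter_corank [Finite G] (s : DowlingGeometry n G) (j : ℕ) :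
    ((Finset.Icc s ⊤).filter fun w => w.corank = j).card =
      triangle (fun i => 1 + Nat.card G * i) s.corank j := by
  classical
  -- A common bound on j and on all coranks, so that both expansions run over the same range.
  let L := (Finset.univ : Finset (DowlingGeometry n G)).sup corank + 1 + j
  have hL : ∀ w : DowlingGeometry n G, w.corank < L := fun w => by
    have := Finset.le_sup (f := corank) (Finset.mem_univ w)
    omega
  refine eq_of_sum_descFactorial_eq (m := Nat.card G) (L := L) Nat.card_pos
    (N := fun j => ((Finset.Icc s ⊤).filter fun w => w.corank = j).card) (fun k => ?_) j
    (by omega)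
  have h1 := sum_triangle_mul_descFactorial (Nat.card G) k s.corank
  rw [← sum_descFactorial_corank,
    ← Finset.sum_fiberwise_of_maps_to (fun w _ => Finset.mem_range.2 (hL w))] at h1
  rw [Finset.sum_subset (Finset.range_subset_range.2 (hL s)) fun i _ hi => by
    rw [triangle_eq_zero _ (by simpa using hi), zero_mul]] at h1
  rw [h1]
  refine Finset.sum_congr rfl fun i _ => ?_
  rw [Finset.sum_congr rfl fun w hw => by rw [(Finset.mem_filter.1 hw).2], Finset.sum_const,
    smul_eq_mul]

theorem corank_le_of_le [Finite G] {s w : DowlingGeometry n G} (h : s ≤ w) :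
    w.corank ≤ s.corank := by
  by_contra hlt
  have h1 := card_filter_corank s w.corank
  rw [triangle_eq_zero _ (not_le.1 hlt), Finset.card_eq_zero] at h1
  exact Finset.notMem_empty w
    (h1 ▸ Finset.mem_filter.2 ⟨Finset.mem_Icc.2 ⟨h, le_top⟩, rfl⟩)

/-- Since T(c, c) = 1, the only element above s with the corank of s is s itself. -/
theorem corank_lt_of_lt [Finite G] {s w : DowlingGeometry n G} (h : s < w) :
    w.corank < s.corank := by
  refine lt_of_le_of_ne (corank_le_of_le h.le) fun e => h.ne ?_
  have h1 := card_filter_corank s s.corank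
  rw [triangle_self] at h1
  exact Finset.card_le_one.1 h1.le s
    (Finset.mem_filter.2 ⟨Finset.mem_Icc.2 ⟨le_rfl, le_top⟩, rfl⟩) w
    (Finset.mem_filter.2 ⟨Finset.mem_Icc.2 ⟨h.le, le_top⟩, e⟩)

theorem sum_corank [Finite G] {M : Type*} [AddCommMonoid M] (s : DowlingGeometry n G)
    (φ : ℕ → M) :
    ∑ w ∈ Finset.Icc s ⊤, φ w.corank =
      ∑ j ∈ Finset.range (s.corank + 1),
        triangle (fun i => 1 + Nat.card G * i) s.corank j • φ j := by
  rw [← Finset.sum_fiberwise_of_maps_to (g := corank) fun w hw => Finset.mem_range.2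
    (Nat.lt_succ_iff.2 (corank_le_of_le (Finset.mem_Icc.1 hw).1))]
  refine Finset.sum_congr rfl fun i _ => ?_
  rw [Finset.sum_congr rfl fun w hw => by rw [(Finset.mem_filter.1 hw).2], Finset.sum_const,
    card_filter_corank]

theorem corank_top : corank (⊤ : DowlingGeometry n G) = 0 := by
  change corank (Quotient.mk _ (⟨⊤, _⟩ : GPrepartition n G)) = 0
  rw [corank_mk, GPrepartition.blockCount, Nat.card_eq_zero]
  left
  refine ⟨fun q => q.2 ?_⟩
  rw [← Quotient.out_eq q.1]
  exact Quotient.sound trivial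

theorem corank_bot : corank (⊥ : DowlingGeometry n G) = n := by
  change corank (Quotient.mk _ (⟨⊥, _⟩ : GPrepartition n G)) = n
  rw [corank_mk, GPrepartition.blockCount]
  have e : {i : Fin (n + 1) // i ≠ 0} ≃
      {q : Quotient (⊥ : Setoid (Fin (n + 1))) // q ≠ Quotient.mk _ 0} :=
    Equiv.ofBijective (fun i => ⟨Quotient.mk _ i.1, fun h => i.2 (Quotient.exact h)⟩) (by
      constructor
      · intro i j h
        exact Subtype.ext (Quotient.exact (congrArg Subtype.val h))
      · rintro ⟨q, hq⟩
        obtain ⟨i, rfl⟩ := Quotient.exists_rep q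
        exact ⟨⟨i, fun h => hq (by rw [h])⟩, rfl⟩)
  rw [← Nat.card_congr e, Nat.card_eq_fintype_card, Fintype.card_subtype_compl]
  simp

theorem rel_bot {i j : Fin (n + 1)} {g : G} :
    Rel (⊥ : DowlingGeometry n G) i j g ↔ i = j ∧ (i ≠ 0 → g = 1) := by
  change Rel (Quotient.mk _ (⟨⊥, _⟩ : GPrepartition n G)) i j g ↔ _
  rw [rel_mk]
  constructor
  · rintro ⟨h, h'⟩
    obtain rfl : i = j := h
    exact ⟨rfl, fun hi => (by simpa using (h' hi hi).symm)⟩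
  · rintro ⟨rfl, h⟩
    exact ⟨rfl, fun hi _ => by simp [h hi]⟩

/-- Making a non-isolated element a singleton block increases the corank by at most one. -/
theorem exists_lt_corank_le [Finite G] {P : DowlingGeometry n G} (hP : P ≠ ⊥) :
    ∃ Q < P, Q.corank ≤ P.corank + 1 := by
  classical
  let A := freeAction (Quotient P.out.part) G
  let A' := freeAction (Option (Quotient P.out.part)) G
  obtain ⟨f, hf0, hf⟩ := exists_hasKer P.out
  -- If no nonzero element is related to a different one, every block is a singleton and P is the
  -- minimum.
  obtain ⟨i, j, g, hi, hij, hr⟩ : ∃ (i j : Fin (n + 1)) (g : G), i ≠ 0 ∧ i ≠ j ∧ P.Rel j i g := by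
    by_contra hno
    apply hP
    refine ext_rel fun i j g => ⟨fun h => ?_, fun h => le_iff_rel.1 bot_le i j g h⟩
    rw [rel_bot]
    have h' : P.Rel j i g⁻¹ := (hf j i _).2 (A.eq_act_symm ((hf i j g).1 h))
    have e : i = j := by
      by_contra hne
      rcases eq_or_ne i 0 with rfl | hi
      · exact hno ⟨j, 0, g, fun h => hne h.symm, fun h => hne h.symm, h⟩
      · exact hno ⟨i, j, g⁻¹, hi, hne, h'⟩
    subst e
    refine ⟨rfl, fun hi => ?_⟩
    rcases A.free _ _ ((hf i i g).1 h).symm with h0 | h0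
    · refine absurd ⟨i, 0, 1, hi, hi, (hf 0 i 1).2 ?_⟩ hno
      rw [h0, hf0, A.zero_act]
    · exact h0
  -- Adjoin a fresh orbit, indexed by `none`, and move i into it; the kernel Q of the new map has
  -- {i} as a block and agrees with P elsewhere.
  let ι : Option (Quotient P.out.part × G) → Option (Option (Quotient P.out.part) × G) :=
    Option.map fun p => (some p.1, p.2)
  have hι : ∀ t g, ι (A.act t g) = A'.act (ι t) g := fun t g => by cases t <;> rfl
  have hιinj : Function.Injective ι := Option.map_injective fun p q h => by
    rw [Prod.mk.injEq, Option.some.injEq] at h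
    exact Prod.ext h.1 h.2
  have hιne : ∀ t g, ι t ≠ some (none, g) := fun t g h => by
    cases t with
    | none => cases h
    | some p => simp [ι] at h
  let f' : Fin (n + 1) → Option (Option (Quotient P.out.part) × G) :=
    Function.update (fun k => ι (f k)) i (some (none, 1))
  have f'i : f' i = some (none, 1) := Function.update_self _ _ _
  have f'ne : ∀ k, k ≠ i → f' k = ι (f k) := fun k hk => Function.update_of_ne hk _ _
  have hnew : ∀ k b, k ≠ i → f' k ≠ A'.act (f' i) b := fun k b hk h => by
    rw [f'ne k hk, f'i] at h
    exact hιne _ _ h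
  obtain ⟨Q, hQ⟩ := A'.exists_ker (f := f') (by rw [f'ne 0 hi.symm, hf0]; rfl)
  have hrestrict : ∀ a b c, a ≠ i → b ≠ i → (Q.Rel a b c ↔ P.Rel a b c) := by
    intro a b c ha hb
    rw [hQ, f'ne a ha, f'ne b hb, ← hι, hιinj.eq_iff]
    exact (hf a b c).symm
  have hQP : Q ≤ P := le_iff_rel.2 fun a b c h => by
    by_cases ha : a = i
    · subst ha
      by_cases hb : b = a
      · subst hb
        rw [hQ, f'i] at h
        obtain rfl : c = 1 := by simpa [A', freeAction] using h.symm
        exact (hf b b 1).2 (A.act_one _).symm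
      · exact absurd ((hQ a b c).1 h) (hnew b c hb)
    · by_cases hb : b = i
      · subst hb
        exact absurd (A'.eq_act_symm ((hQ a b c).1 h)) (hnew a c⁻¹ ha)
      · exact (hrestrict a b c ha hb).1 h
  refine ⟨Q, lt_of_le_of_ne hQP ?_, ?_⟩
  · rintro rfl
    exact hnew j g⁻¹ hij.symm (A'.eq_act_symm ((hQ j i g).1 hr))
  -- Coranks are compared through the counts (1 + m)^corank of compatible maps to the set with one
  -- free orbit. A map compatible with Q becomes compatible with P once its value at i is reset to
  -- that at j times g; remembering the old value at i makes this injective.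
  · let B := freeAction (Fin 1) G
    have hfun : ∀ h : {h // B.Compatible Q.out h},
        B.Compatible P.out (Function.update h.1 i (B.act (h.1 j) g)) := by
      rintro ⟨h, h0, hh⟩
      have hQr : ∀ a b c, a ≠ i → b ≠ i → P.Rel a b c → h b = B.act (h a) c :=
        fun a b c ha hb hab => hh a b c ((hrestrict a b c ha hb).2 hab)
      have hji : f i = A.act (f j) g := (hf j i g).1 hr
      have hj : j ≠ i := hij.symm
      dsimp only
      refine ⟨(Function.update_of_ne hi.symm _ _).trans h0, fun a b c hab => ?_⟩
      have hab' : f b = A.act (f a) c := (hf a b c).1 hab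
      by_cases ha : a = i
      · subst ha
        rw [Function.update_self]
        by_cases hb : b = a
        · subst hb
          rw [Function.update_self]
          -- If i lies in the zero block of P, it is related to itself by every c, so the relation
          -- must be carried over to j, where c becomes its conjugate by g.
          have e := hQr j j (g * c * g⁻¹) hj hj ((hf _ _ _).2 (by
            rw [← A.act_act, ← A.act_act, ← hji, ← hab', hji, A.act_act, mul_inv_cancel,
              A.act_one]))
          rw [B.act_act]
          conv_lhs => rw [e, B.act_act, inv_mul_cancel_right]
        · rw [Function.update_of_ne hb, B.act_act]
          exact hQr j b (g * c) hj hb ((hf _ _ _).2 (by rw [hab', hji, A.act_act]))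
      · rw [Function.update_of_ne ha]
        by_cases hb : b = i
        · subst hb
          rw [Function.update_self, hQr a j (c * g⁻¹) ha hj ((hf _ _ _).2 (by
            rw [← A.act_act, ← hab', hji, A.act_act, mul_inv_cancel, A.act_one])), B.act_act,
            inv_mul_cancel_right]
        · rw [Function.update_of_ne hb]
          exact hQr a b c ha hb hab
    let Φ : {h // B.Compatible Q.out h} →
        {h // B.Compatible P.out h} × Option (Fin 1 × G) := fun h => (⟨_, hfun h⟩, h.1 i)
    have hΦ : Function.Injective Φ := by
      intro h k e
      have e1 := congrArg Subtype.val (congrArg Prod.fst e)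
      have e2 : h.1 i = k.1 i := congrArg Prod.snd e
      apply Subtype.ext
      funext a
      by_cases ha : a = i
      · rw [ha, e2]
      · have := congrFun e1 a
        simpa only [Φ, Function.update_of_ne ha] using this
    have hcard := Nat.card_le_card_of_injective Φ hΦ
    rw [Nat.card_prod, B.card_compatible, B.card_compatible, ← pow_succ, card_orbits _ G] at hcard
    have hG : 0 < Nat.card G := Nat.card_pos
    exact (Nat.pow_le_pow_iff_right (by omega)).1 hcard

theorem corank_le (s : DowlingGeometry n G) [Finite G] : s.corank ≤ n := by
  have h := corank_le_of_le (bot_le (a := s))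
  rwa [corank_bot] at h

/-- The corank drops strictly along chains, which bounds the height above; going down by
`exists_lt_corank_le` loses no more than one per step, which bounds it below. -/
theorem height_eq [Finite G] (s : DowlingGeometry n G) :
    Order.height s = ((n - s.corank : ℕ) : ℕ∞) := by
  induction s using WellFoundedLT.induction with
  | ind s ih =>
    apply le_antisymm
    · rw [Order.height_le_coe_iff]
      intro y hy
      rw [ih y hy, Nat.cast_lt]
      have h1 := corank_lt_of_lt hy
      have h2 := corank_le y
      omega
    · by_cases hs : s = ⊥
      · rw [hs, corank_bot, Nat.sub_self, Nat.cast_zero]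
        exact zero_le
      · obtain ⟨Q, hQ, hc⟩ := exists_lt_corank_le hs
        have h := Order.height_add_one_le hQ
        rw [ih Q hQ] at h
        refine le_trans ?_ h
        have h1 := corank_lt_of_lt hQ
        have h2 := corank_le Q
        exact_mod_cast (by omega : n - s.corank ≤ n - Q.corank + 1)

theorem posetRank_eq [Finite G] (s : DowlingGeometry n G) : posetRank s = n - s.corank := by
  rw [posetRank, height_eq, ENat.toNat_natCast]

end DowlingGeometry

/-! ## Real-rootedness -/

/-- Integer coefficients make the zero set symmetric under conjugation, so it suffices to test the
nonreal points that τ maps to the closed upper half-plane. -/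
theorem realRooted_of_forall {p : ℤ[X]} (τ : ℂ → ℂ)
    (hτ : ∀ z, τ (starRingEnd ℂ z) = starRingEnd ℂ (τ z))
    (h : ∀ z : ℂ, z.im ≠ 0 → 0 ≤ (τ z).im → aeval z p ≠ 0) : RealRooted p := by
  intro z hz
  by_contra him
  rcases le_total 0 (τ z).im with h0 | h0
  · exact h z him h0 hz
  · refine h (starRingEnd ℂ z) (by simpa using him) (by rw [hτ]; simpa using h0) ?_
    have e : starRingEnd ℂ (aeval z p) = aeval (starRingEnd ℂ z) p := by
      rw [aeval_def, aeval_def, hom_eval₂]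
      congr 1
      exact RingHom.ext_int _ _
    rw [← e, hz, map_zero]

/-- The solution of the Chow recursion of a triangular array. -/
noncomputable def chowSeq (a : ℕ → ℕ) (x : ℂ) (n : ℕ) : ℂ :=
  1 + ∑ k : Fin n, (triangle a n k : ℂ) * ((x - x ^ (n - k)) / (1 - x)) * chowSeq a x k
termination_by n
decreasing_by exact k.2

theorem rowSum_chowSeq (a : ℕ → ℕ) {x : ℂ} (hx : 1 - x ≠ 0) (n : ℕ) :
    rowSum a x (chowSeq a x) n = x * rowSum a 1 (chowSeq a x) n + (1 - x) := by
  have e : (1 - x) * chowSeq a x n = (1 - x) +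
      (x * ∑ k ∈ Finset.range n, (triangle a n k : ℂ) * 1 ^ (n - k) * chowSeq a x k -
        ∑ k ∈ Finset.range n, (triangle a n k : ℂ) * x ^ (n - k) * chowSeq a x k) := by
    rw [chowSeq, mul_add, mul_one, Finset.mul_sum, Finset.mul_sum, ← Finset.sum_sub_distrib,
      Finset.sum_range]
    congr 1
    refine Finset.sum_congr rfl fun k _ => ?_
    field_simp
    ring
  rw [rowSum_eq_range_add, rowSum_eq_range_add]
  linear_combination e

/-- The solution of the recursion for chains of a triangular array. -/
noncomputable def chainSeq (a : ℕ → ℕ) (y : ℂ) : ℕ → ℂ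
  | 0 => 1
  | n + 1 => y / (1 - y) *
      ∑ k : Fin (n + 1), (triangle a (n + 1) k : ℂ) * (1 - y) ^ (n + 1 - k) * chainSeq a y k
decreasing_by exact k.2

theorem chainSeq_succ (a : ℕ → ℕ) {y : ℂ} (hy : 1 - y ≠ 0) (n : ℕ) :
    chainSeq a y (n + 1) = y * rowSum a (1 - y) (chainSeq a y) (n + 1) := by
  have e : (1 - y) * chainSeq a y (n + 1) = y * ∑ k ∈ Finset.range (n + 1),
      (triangle a (n + 1) k : ℂ) * (1 - y) ^ (n + 1 - k) * chainSeq a y k := by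
    rw [chainSeq, Finset.sum_range]
    field_simp
  rw [rowSum_eq_range_add]
  linear_combination e

namespace DowlingGeometry

variable {n : ℕ} {G : Type*} [Group G]

/-- The normalized chain polynomial of the upper interval of an element. -/
noncomputable def chainValue (y : ℂ) (s : DowlingGeometry n G) : ℂ :=
  chainSeq (fun i => 1 + Nat.card G * i) y s.corank / (1 - y) ^ s.corank

theorem chainValue_bot_ne_zero {y : ℂ} (hy : 0 < y.im) (hy1 : 1 - y ≠ 0) :
    chainValue y (⊥ : DowlingGeometry n G) ≠ 0 :=
  div_ne_zero (ne_zero_of_chain_recursion (fun i => by positivity) hy (by rw [chainSeq])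
    (chainSeq_succ _ hy1) _) (pow_ne_zero _ hy1)

variable [Finite G]

/-- Weighted sums over upper intervals are weighted row sums. -/
theorem sum_Icc_eq_rowSum (z : ℂ) (f : ℕ → ℂ) (s : DowlingGeometry n G) :
    ∑ w ∈ Finset.Icc s ⊤, z ^ (s.corank - w.corank) * f w.corank =
      rowSum (fun i => 1 + Nat.card G * i) z f s.corank := by
  rw [sum_corank s fun j => z ^ (s.corank - j) * f j, rowSum]
  simp only [nsmul_eq_mul, mul_assoc]

theorem posetRank_sub {s w : DowlingGeometry n G} :
    posetRank w - posetRank s = s.corank - w.corank := by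
  rw [posetRank_eq, posetRank_eq]
  have h1 := corank_le s
  have h2 := corank_le w
  omega

theorem aeval_weightedChowSum (x : ℂ) (s : DowlingGeometry n G) :
    aeval x (weightedChowSum s ⊤) = ∑ w ∈ Finset.Icc s ⊤,
      x ^ (s.corank - w.corank) * aeval x (intervalChowPoly w ⊤) := by
  rw [weightedChowSum, map_sum]
  refine Finset.sum_congr rfl fun w _ => ?_
  rw [map_mul, map_pow, aeval_X, posetRank_sub]

/-- Downward induction from the maximum. Both sides satisfy the recursion of `weightedChowSum_eq`,
whose term w = s carries the coefficient 1 - x. -/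
theorem aeval_intervalChowPoly {x : ℂ} (hx : 1 - x ≠ 0) (s : DowlingGeometry n G) :
    aeval x (intervalChowPoly s ⊤) =
      chowSeq (fun i => 1 + Nat.card G * i) x s.corank := by
  induction s using WellFoundedGT.induction with
  | ind s ih =>
    have h1 := congrArg (aeval x) (weightedChowSum_eq (le_top (a := s)))
    rw [aeval_weightedChowSum] at h1
    simp only [map_add, map_mul, map_sum, map_sub, map_one, aeval_X] at h1
    have h2 := rowSum_chowSeq (fun i => 1 + Nat.card G * i) hx s.corank
    rw [← sum_Icc_eq_rowSum, ← sum_Icc_eq_rowSum] at h2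
    simp only [one_pow, one_mul] at h2
    rw [← Finset.sum_Ioc_add_eq_sum_Icc le_top, ← Finset.sum_Ioc_add_eq_sum_Icc le_top,
      Nat.sub_self, pow_zero, one_mul] at h1 h2
    have e1 := Finset.sum_congr (rfl : Finset.Ioc s ⊤ = Finset.Ioc s ⊤) fun w hw =>
      congrArg (x ^ (s.corank - w.corank) * ·) (ih w (Finset.mem_Ioc.1 hw).1)
    have e2 := Finset.sum_congr (rfl : Finset.Ioc s ⊤ = Finset.Ioc s ⊤) fun w hw =>
      ih w (Finset.mem_Ioc.1 hw).1
    rw [e1, e2] at h1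
    apply mul_left_cancel₀ hx
    linear_combination h1 - h2

theorem aeval_augmentedChowPolynomial {x : ℂ} (hx : 1 - x ≠ 0) :
    aeval x (augmentedChowPolynomial (DowlingGeometry n G)) =
      rowSum (fun i => 1 + Nat.card G * i) x
        (chowSeq (fun i => 1 + Nat.card G * i) x) n := by
  -- At the minimum the weighted sum is the augmented Chow polynomial, because the minimum has rank
  -- 0.
  have e : augmentedChowPolynomial (DowlingGeometry n G) =
      weightedChowSum (⊥ : DowlingGeometry n G) ⊤ := by
    rw [augmentedChowPolynomial, weightedChowSum]
    refine Finset.sum_congr rfl fun s _ => ?_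
    rw [posetRank_eq (⊥ : DowlingGeometry n G), corank_bot, Nat.sub_self, Nat.sub_zero]
  rw [e, aeval_weightedChowSum, Finset.sum_congr rfl fun w _ => by
    rw [aeval_intervalChowPoly hx], sum_Icc_eq_rowSum, corank_bot]

theorem conj_div_one_add_sq (z : ℂ) : starRingEnd ℂ z / (1 + starRingEnd ℂ z) ^ 2 =
    starRingEnd ℂ (z / (1 + z) ^ 2) := by
  simp only [map_div₀, map_pow, map_add, map_one]

theorem realRooted_augmentedChowPolynomial :
    RealRooted (augmentedChowPolynomial (DowlingGeometry n G)) := by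
  refine realRooted_of_forall (fun z => z / (1 + z) ^ 2) conj_div_one_add_sq fun z hz ht => ?_
  have hz1 : 1 - z ≠ 0 := fun h => hz (by simpa using congrArg Complex.im h)
  rw [aeval_augmentedChowPolynomial hz1]
  exact (ne_zero_of_chow_recursion (by simp) (fun i => by positivity) hz ht
    (rowSum_chowSeq _ hz1) n).1

theorem realRooted_chowPolynomial (hn : n ≠ 0) :
    RealRooted (chowPolynomial (DowlingGeometry n G)) := by
  refine realRooted_of_forall (fun z => z / (1 + z) ^ 2) conj_div_one_add_sq fun z hz ht => ?_
  have hz1 : 1 - z ≠ 0 := fun h => hz (by simpa using congrArg Complex.im h)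
  obtain ⟨k, rfl⟩ := Nat.exists_eq_succ_of_ne_zero hn
  rw [chowPolynomial, aeval_intervalChowPoly hz1, corank_bot]
  exact (ne_zero_of_chow_recursion (by simp) (fun i => by positivity) hz ht
    (rowSum_chowSeq _ hz1) k).2

theorem lt_top_iff_corank {s : DowlingGeometry n G} : s < ⊤ ↔ s.corank ≠ 0 := by
  refine ⟨fun h => ?_, fun h => lt_top_iff_ne_top.2 fun e => h (by rw [e, corank_top])⟩
  have := corank_lt_of_lt h
  omega

/-- Dividing the row recursion by (1 - y)^{cork s} leaves `chainValue y s` as y times the sum of the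
values over [s, ⊤]; the maximum has value 1. -/
theorem sum_Ioo_chainValue {y : ℂ} (hy : y ≠ 0) (hy1 : 1 - y ≠ 0) {s : DowlingGeometry n G}
    (hs : s < ⊤) :
    ∑ v ∈ Finset.Ioo s ⊤, chainValue y v = chainValue y s * (1 - y) / y - 1 := by
  obtain ⟨N, hN⟩ := Nat.exists_eq_succ_of_ne_zero (lt_top_iff_corank.1 hs)
  have h1 := chainSeq_succ (fun i => 1 + Nat.card G * i) hy1 N
  rw [← Nat.succ_eq_add_one, ← hN, ← sum_Icc_eq_rowSum] at h1
  have h2 : ∑ w ∈ Finset.Icc s ⊤, (1 - y) ^ (s.corank - w.corank) *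
      chainSeq (fun i => 1 + Nat.card G * i) y w.corank =
      (1 - y) ^ s.corank * ∑ w ∈ Finset.Icc s ⊤, chainValue y w := by
    rw [Finset.mul_sum]
    refine Finset.sum_congr rfl fun w hw => ?_
    have hc := corank_le_of_le (Finset.mem_Icc.1 hw).1
    rw [chainValue, ← Nat.sub_add_cancel hc, pow_add, Nat.add_sub_cancel]
    field_simp
  have h3 : chainValue y (⊤ : DowlingGeometry n G) = 1 := by
    rw [chainValue, corank_top, pow_zero, div_one, chainSeq]
  have h4 : chainSeq (fun i => 1 + Nat.card G * i) y s.corank =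
      (1 - y) ^ s.corank * chainValue y s := by
    rw [chainValue]
    field_simp
  rw [h2, h4, ← Finset.sum_Ioc_add_eq_sum_Icc hs.le, ← Finset.sum_Ioo_add_eq_sum_Ioc hs,
    h3] at h1
  have h5 : chainValue y s = y * (∑ v ∈ Finset.Ioo s ⊤, chainValue y v + 1 + chainValue y s) :=
    mul_left_cancel₀ (pow_ne_zero s.corank hy1) (by linear_combination h1)
  field_simp
  linear_combination -h5

theorem bot_lt_top_of_ne_zero (hn : n ≠ 0) : (⊥ : DowlingGeometry n G) < ⊤ := by
  rwa [lt_top_iff_corank, corank_bot]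

theorem realRooted_hPolynomial_properPart (hn : n ≠ 0) :
    RealRooted (hPolynomial (orderComplex
      (Set.Ioo (⊥ : DowlingGeometry n G) (⊤ : DowlingGeometry n G)))) := by
  classical
  refine realRooted_of_forall id (fun _ => rfl) fun y him hy => ?_
  have hy : 0 < y.im := lt_of_le_of_ne hy him.symm
  have hy0 : y ≠ 0 := fun h => him (by rw [h, Complex.zero_im])
  have hy1 : 1 - y ≠ 0 := fun h => him (by simpa using congrArg Complex.im h)
  have : Fintype (Set.Ioo (⊥ : DowlingGeometry n G) (⊤ : DowlingGeometry n G)) :=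
    Fintype.ofFinite _
  have hsum : ∀ s : DowlingGeometry n G, ∑ v : Set.Ioo (⊥ : DowlingGeometry n G) ⊤ with s < v.1,
      chainValue y v.1 * (1 - y) / y =
        (∑ v ∈ Finset.Ioo s ⊤, chainValue y v) * (1 - y) / y := fun s => by
    rw [Finset.sum_mul, Finset.sum_div]
    refine Finset.sum_bij (fun v _ => v.1) (fun v hv => ?_) (fun v _ w _ h => Subtype.ext h)
      (fun v hv => ?_) fun _ _ => rfl
    · exact Finset.mem_Ioo.2 ⟨(Finset.mem_filter.1 hv).2, v.2.2⟩
    · obtain ⟨h1, h2⟩ := Finset.mem_Ioo.1 hv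
      exact ⟨⟨v, bot_le.trans_lt h1, h2⟩, Finset.mem_filter.2 ⟨Finset.mem_univ _, h1⟩, rfl⟩
  -- With t = y/(1 - y), `chainValue` weights a chain from v to the maximum by t per step. A chain
  -- with k interior elements has k + 1 steps, so division by t gives the face count of the open
  -- interval.
  rw [aeval_hPolynomial _ hy1, sum_faceFinset_of_recursion (y / (1 - y))
    (K := fun v : Set.Ioo (⊥ : DowlingGeometry n G) ⊤ => chainValue y v.1 * (1 - y) / y)]
  · refine mul_ne_zero (pow_ne_zero _ hy1) ?_
    have e : ∑ v : Set.Ioo (⊥ : DowlingGeometry n G) ⊤, chainValue y v.1 * (1 - y) / y =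
        ∑ v : Set.Ioo (⊥ : DowlingGeometry n G) ⊤ with ⊥ < v.1,
          chainValue y v.1 * (1 - y) / y := by
      rw [Finset.filter_true_of_mem fun v _ => v.2.1]
    rw [e, hsum, sum_Ioo_chainValue hy0 hy1 (bot_lt_top_of_ne_zero hn)]
    have h0 := chainValue_bot_ne_zero (n := n) (G := G) hy hy1
    have e2 : 1 + y / (1 - y) * ((chainValue y (⊥ : DowlingGeometry n G) * (1 - y) / y - 1) *
        (1 - y) / y) = chainValue y (⊥ : DowlingGeometry n G) * ((1 - y) / y) := by
      field_simp
      ring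
    rw [e2]
    exact mul_ne_zero h0 (div_ne_zero hy1 hy0)
  · intro w
    have e := hsum w.1
    rw [sum_Ioo_chainValue hy0 hy1 w.2.2] at e
    have e3 : (Finset.univ.filter (w < ·)) = Finset.univ.filter
        fun v : Set.Ioo (⊥ : DowlingGeometry n G) ⊤ => w.1 < v.1 := rfl
    rw [e3, e]
    field_simp
    ring

theorem realRooted_hPolynomial (hn : n ≠ 0) :
    RealRooted (hPolynomial (orderComplex (DowlingGeometry n G))) := by
  classical
  refine realRooted_of_forall id (fun _ => rfl) fun y him hy => ?_
  have hy : 0 < y.im := lt_of_le_of_ne hy him.symm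
  have hy0 : y ≠ 0 := fun h => him (by rw [h, Complex.zero_im])
  have hy1 : 1 - y ≠ 0 := fun h => him (by simpa using congrArg Complex.im h)
  -- Including the maximum multiplies the count of the open interval by 1 + t = 1/(1 - y). Above the
  -- maximum there is only the empty chain, hence the separate value.
  let K : DowlingGeometry n G → ℂ := fun s => if s = ⊤ then 1 else chainValue y s / y
  have hK : ∀ s : DowlingGeometry n G,
      K s = 1 + y / (1 - y) * ∑ v ∈ Finset.univ.filter (s < ·), K v := by
    intro s
    have e : Finset.univ.filter (s < ·) = Finset.Ioc s ⊤ := by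
      ext v
      simp
    rw [e]
    rcases eq_or_lt_of_le (le_top (a := s)) with rfl | hs
    · simp [K]
    · have e1 : ∑ v ∈ Finset.Ioo s ⊤, K v = (∑ v ∈ Finset.Ioo s ⊤, chainValue y v) / y := by
        rw [Finset.sum_div]
        exact Finset.sum_congr rfl fun v hv => if_neg (Finset.mem_Ioo.1 hv).2.ne
      rw [← Finset.sum_Ioo_add_eq_sum_Ioc hs, e1, sum_Ioo_chainValue hy0 hy1 hs]
      simp only [K, if_neg hs.ne, if_true]
      field_simp
      ring
  rw [aeval_hPolynomial _ hy1, sum_faceFinset_of_recursion (y / (1 - y)) hK]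
  refine mul_ne_zero (pow_ne_zero _ hy1) ?_
  have hb := bot_lt_top_of_ne_zero (n := n) (G := G) hn
  have e : ∑ w, K w = ∑ v ∈ Finset.univ.filter ((⊥ : DowlingGeometry n G) < ·), K v + K ⊥ := by
    have h1 : Finset.univ.filter ((⊥ : DowlingGeometry n G) < ·) = Finset.univ.erase ⊥ := by
      ext v
      simp [bot_lt_iff_ne_bot]
    rw [h1, Finset.sum_erase_add _ _ (Finset.mem_univ _)]
  have e2 : 1 + y / (1 - y) * ∑ w, K w = (1 + y / (1 - y)) * K ⊥ := by
    rw [e]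
    linear_combination -hK ⊥
  have e3 : (1 + y / (1 - y)) * K ⊥ =
      chainValue y (⊥ : DowlingGeometry n G) / ((1 - y) * y) := by
    simp only [K, if_neg hb.ne]
    field_simp
    ring
  rw [e2, e3]
  exact div_ne_zero (chainValue_bot_ne_zero hy hy1) (mul_ne_zero hy1 hy0)

end DowlingGeometry

/-! ## Intersection lattices -/

namespace DowlingGeometry

open PointedAction

variable {n : ℕ} {G : Type*} [Group G]

/-- Hyperplanes `L i j g` that correspond to the relations `i ~ j` with ratio `g` give an
isomorphism of the Dowling geometry with an intersection lattice. -/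
theorem nonempty_orderIso_intersectionLattice {V : Type*} [AddCommGroup V] [Module ℂ V]
    {A : Set (Submodule ℂ V)} (L : Fin (n + 1) → Fin (n + 1) → G → Submodule ℂ V)
    (hA : ∀ H ∈ A, ∃ i j g, H = L i j g) (hL : ∀ i j g, L i j g = ⊤ ∨ L i j g ∈ A)
    (hsep : ∀ (P : DowlingGeometry n G) (i j : Fin (n + 1)) (g : G),
      (∀ x, (∀ k l c, P.Rel k l c → x ∈ L k l c) → x ∈ L i j g) → P.Rel i j g)
    (hker : ∀ U : Submodule ℂ V, ∃ P : DowlingGeometry n G,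
      ∀ i j g, P.Rel i j g ↔ U ≤ L i j g) :
    Nonempty (DowlingGeometry n G ≃o IntersectionLattice A) := by
  let S : DowlingGeometry n G → Set (Submodule ℂ V) := fun P =>
    {H | H ∈ A ∧ ∃ i j g, P.Rel i j g ∧ H = L i j g}
  have hle : ∀ (P : DowlingGeometry n G) i j g, sInf (S P) ≤ L i j g ↔ P.Rel i j g := by
    intro P i j g
    refine ⟨fun h => hsep P i j g fun x hx => h ?_, fun h => ?_⟩
    · rw [Submodule.mem_sInf]
      rintro H ⟨_, k, l, c, hr, rfl⟩
      exact hx k l c hr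
    · rcases hL i j g with e | e
      · rw [e]
        exact le_top
      · exact sInf_le ⟨e, i, j, g, h, rfl⟩
  let f : DowlingGeometry n G → IntersectionLattice A := fun P =>
    OrderDual.toDual ⟨sInf (S P), S P, fun H h => h.1, rfl⟩
  have hf : ∀ P Q, f P ≤ f Q ↔ P ≤ Q := by
    intro P Q
    rw [le_iff_rel]
    change sInf (S Q) ≤ sInf (S P) ↔ _
    constructor
    · intro h i j g hr
      exact (hle Q i j g).1 (h.trans ((hle P i j g).2 hr))
    · intro h
      refine le_sInf ?_
      rintro H ⟨_, i, j, g, hr, rfl⟩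
      exact (hle Q i j g).2 (h i j g hr)
  refine ⟨RelIso.ofSurjective (OrderEmbedding.ofMapLEIff f hf) ?_⟩
  rintro ⟨U, T, hT, rfl⟩
  -- The preimage of a flat is the set of all relations that hold on it.
  obtain ⟨P, hP⟩ := hker (sInf T)
  refine ⟨P, congrArg OrderDual.toDual (Subtype.ext (le_antisymm (le_sInf fun H hH => ?_)
    (le_sInf ?_)))⟩
  · obtain ⟨i, j, g, rfl⟩ := hA H (hT hH)
    exact (hle P i j g).2 ((hP i j g).2 (sInf_le hH))
  · rintro H ⟨_, i, j, g, hr, rfl⟩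
    exact (hP i j g).1 hr

theorem nonempty_orderIso_braidArrangementA (hG : Nat.card G = 1) :
    Nonempty (DowlingGeometry n G ≃o IntersectionLattice (braidArrangementA (n + 1))) := by
  classical
  have hsub : Subsingleton G := (Nat.card_eq_one_iff_unique.1 hG).1
  let L : Fin (n + 1) → Fin (n + 1) → G → Submodule ℂ (Fin (n + 1) → ℂ) := fun i j _ =>
    LinearMap.ker ((LinearMap.proj j : (Fin (n + 1) → ℂ) →ₗ[ℂ] ℂ) - LinearMap.proj i)
  have hmem : ∀ i j g x, x ∈ L i j g ↔ x j = x i := fun i j g x => by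
    simp [L, sub_eq_zero]
  refine nonempty_orderIso_intersectionLattice L ?_ ?_ ?_ ?_
  · rintro H ⟨i, j, _, hH⟩
    refine ⟨j, i, 1, SetLike.coe_injective ?_⟩
    rw [hH]
    ext x
    exact (hmem j i 1 x).symm
  · intro i j g
    rcases lt_trichotomy i j with h | rfl | h
    · refine Or.inr ⟨i, j, h, ?_⟩
      ext x
      exact (hmem i j g x).trans eq_comm
    · left
      ext x
      simp [hmem]
    · refine Or.inr ⟨j, i, h, ?_⟩
      ext x
      exact hmem i j g x
  · intro P i j g h
    obtain ⟨f, _, hf⟩ := exists_hasKer P.out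
    have hact : ∀ t c, (freeAction (Quotient P.out.part) G).act t c = t := fun t c => by
      rw [Subsingleton.elim c 1, (freeAction _ G).act_one]
    -- The test point is the indicator of the fiber of f through j; it satisfies all relations of P
    -- and separates i from j unless they are related.
    have h1 := h (fun k => if f k = f j then 1 else 0) fun k l c hr => (hmem k l c _).2 (by
      rw [(hf k l c).1 hr, hact])
    rw [hmem i j g, if_pos rfl] at h1
    refine (hf i j g).2 ?_
    rw [hact]
    by_contra hne
    rw [if_neg (Ne.symm hne)] at h1
    exact one_ne_zero h1
  · intro U
    let B : PointedAction (U → ℂ) G :=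
      { act := fun t _ => t
        zero := 0
        act_one := fun _ => rfl
        act_act := fun _ _ _ => rfl
        zero_act := fun _ => rfl
        free := fun _ _ _ => Or.inr (Subsingleton.elim _ _) }
    -- Subtracting x_0 sends the index 0 to the base point without affecting the equations x_i =
    -- x_j.
    obtain ⟨P, hP⟩ := B.exists_ker (n := n) (f := fun i x => x.1 i - x.1 0)
      (funext fun x => sub_self _)
    refine ⟨P, fun i j g => (hP i j g).trans ⟨fun h x hx => ?_, fun h => funext fun x => ?_⟩⟩
    · have := congrFun h ⟨x, hx⟩
      rw [hmem i j g]
      exact sub_left_injective this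
    · have := (hmem i j g x.1).1 (h x.2)
      exact congrArg (· - x.1 0) this

theorem nonempty_orderIso_braidArrangementB (hG : Nat.card G = 2) :
    Nonempty (DowlingGeometry n G ≃o IntersectionLattice (braidArrangementB n)) := by
  classical
  obtain ⟨g₀, hg₀, huniv⟩ : ∃ g₀ : G, g₀ ≠ 1 ∧ ∀ g, g = 1 ∨ g = g₀ := by
    obtain ⟨a, b, hab, hu⟩ := Nat.card_eq_two_iff.1 hG
    have hu' : ∀ g : G, g = a ∨ g = b := fun g => by
      have : g ∈ ({a, b} : Set G) := hu ▸ Set.mem_univ g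
      simpa using this
    rcases hu' 1 with h | h
    · exact ⟨b, fun e => hab (h.symm.trans e.symm), fun g => h ▸ hu' g⟩
    · exact ⟨a, fun e => hab (e.trans h), fun g => h ▸ (hu' g).symm⟩
  have hsq : g₀ * g₀ = 1 := (huniv (g₀ * g₀)).resolve_right fun h => hg₀ (mul_eq_left.1 h)
  let ε : G → ℂ := fun g => if g = 1 then 1 else -1
  have ε1 : ε 1 = 1 := if_pos rfl
  have ε0 : ε g₀ = -1 := if_neg hg₀
  have εmul : ∀ g h, ε (g * h) = ε g * ε h := by
    intro g h
    rcases huniv g with rfl | rfl <;> rcases huniv h with rfl | rfl <;>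
      simp only [one_mul, mul_one, hsq, ε1, ε0, mul_neg, neg_neg]
  have εne : ∀ g, ε g ≠ 0 := fun g => by
    rcases huniv g with rfl | rfl <;> simp [ε1, ε0]
  have εinj : ∀ g h, ε g = ε h → g = h := by
    intro g h e
    have h1 : (1 : ℂ) ≠ -1 := by norm_num
    rcases huniv g with rfl | rfl <;> rcases huniv h with rfl | rfl
    · rfl
    · rw [ε1, ε0] at e
      exact absurd e h1
    · rw [ε1, ε0] at e
      exact absurd e.symm h1
    · rfl
  -- The index 0 carries the zero functional, so the coordinate hyperplane x_k = 0 is the relation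
  -- between 0 and k.
  let ξ : Fin (n + 1) → (Fin n → ℂ) →ₗ[ℂ] ℂ := Fin.cases 0 fun i => LinearMap.proj i
  have ξ0 : ∀ x, ξ 0 x = 0 := fun x => rfl
  have ξs : ∀ i x, ξ (Fin.succ i) x = x i := fun i x => rfl
  let L : Fin (n + 1) → Fin (n + 1) → G → Submodule ℂ (Fin n → ℂ) := fun i j g =>
    LinearMap.ker (ξ j - ε g • ξ i)
  have hmem : ∀ i j g x, x ∈ L i j g ↔ ξ j x = ε g * ξ i x := fun i j g x => by
    simp [L, sub_eq_zero]
  refine nonempty_orderIso_intersectionLattice L ?_ ?_ ?_ ?_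
  · rintro H (⟨i, j, _, hH⟩ | ⟨i, j, _, hH⟩ | ⟨k, hH⟩)
    · refine ⟨j.succ, i.succ, 1, SetLike.coe_injective ?_⟩
      rw [hH]
      ext x
      rw [SetLike.mem_coe, hmem, ξs, ξs, ε1, one_mul, Set.mem_ofPred_eq]
    · refine ⟨j.succ, i.succ, g₀, SetLike.coe_injective ?_⟩
      rw [hH]
      ext x
      rw [SetLike.mem_coe, hmem, ξs, ξs, ε0, neg_one_mul, Set.mem_ofPred_eq]
    · refine ⟨0, k.succ, 1, SetLike.coe_injective ?_⟩
      rw [hH]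
      ext x
      rw [SetLike.mem_coe, hmem, ξs, ξ0, mul_zero, Set.mem_ofPred_eq]
  · intro i j g
    refine Fin.cases ?_ (fun i => ?_) i <;> refine Fin.cases ?_ (fun j => ?_) j
    · left
      ext x
      simp [hmem, ξ0]
    · refine Or.inr (Or.inr (Or.inr ⟨j, ?_⟩))
      ext x
      rw [SetLike.mem_coe, hmem, ξs, ξ0, mul_zero, Set.mem_ofPred_eq]
    · refine Or.inr (Or.inr (Or.inr ⟨i, ?_⟩))
      ext x
      rw [SetLike.mem_coe, hmem, ξs, ξ0, Set.mem_ofPred_eq, eq_comm, mul_eq_zero,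
        or_iff_right (εne g)]
    · rcases huniv g with rfl | rfl <;> rcases lt_trichotomy i j with h | rfl | h
      · refine Or.inr (Or.inl ⟨i, j, h, ?_⟩)
        ext x
        rw [SetLike.mem_coe, hmem, ξs, ξs, ε1, one_mul, Set.mem_ofPred_eq, eq_comm]
      · left
        ext x
        simp [hmem, ε1]
      · refine Or.inr (Or.inl ⟨j, i, h, ?_⟩)
        ext x
        rw [SetLike.mem_coe, hmem, ξs, ξs, ε1, one_mul, Set.mem_ofPred_eq]
      · refine Or.inr (Or.inr (Or.inl ⟨i, j, h, ?_⟩))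
        ext x
        rw [SetLike.mem_coe, hmem, ξs, ξs, ε0, neg_one_mul, Set.mem_ofPred_eq, eq_neg_iff_add_eq_zero,
          eq_neg_iff_add_eq_zero, add_comm]
      -- The relation of i to itself by the nontrivial element reads x_i = -x_i, again a coordinate
      -- hyperplane.
      · refine Or.inr (Or.inr (Or.inr ⟨i, ?_⟩))
        ext x
        rw [SetLike.mem_coe, hmem, ξs, ε0, neg_one_mul, Set.mem_ofPred_eq, self_eq_neg]
      · refine Or.inr (Or.inr (Or.inl ⟨j, i, h, ?_⟩))
        ext x
        rw [SetLike.mem_coe, hmem, ξs, ξs, ε0, neg_one_mul, Set.mem_ofPred_eq]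
  · intro P i j g h
    obtain ⟨f, hf0, hf⟩ := exists_hasKer P.out
    refine (hf i j g).2 ?_
    -- The signed coordinate of the orbit q. These functions are equivariant for the sign character,
    -- so they give points on the flat of P, and together they separate the points of the free
    -- pointed set.
    let F : Quotient P.out.part → Option (Quotient P.out.part × G) → ℂ := fun q t =>
      t.elim 0 fun p => if p.1 = q then ε p.2 else 0
    have hF : ∀ q t c, F q ((freeAction _ G).act t c) = ε c * F q t := fun q t c => by
      cases t with
      | none => exact (mul_zero _).symm
      | some p =>
        simp only [F, freeAction, Option.map_some, Option.elim_some, εmul]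
        split_ifs
        · exact mul_comm _ _
        · exact (mul_zero _).symm
    have key : ∀ q, F q (f j) = ε g * F q (f i) := by
      intro q
      have hξ : ∀ k, ξ k (fun l => F q (f l.succ)) = F q (f k) := fun k => by
        refine Fin.cases ?_ (fun l => ?_) k
        · rw [ξ0, hf0]
          rfl
        · rw [ξs]
      have h1 := h (fun l => F q (f l.succ)) fun k l c hr => by
        rw [hmem, hξ, hξ, (hf k l c).1 hr, hF]
      rwa [hmem, hξ, hξ] at h1
    rcases hi : f i with _ | ⟨q, u⟩
    · rcases hj : f j with _ | ⟨q, u⟩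
      · rfl
      · have := key q
        rw [hi, hj] at this
        simp [F, εne] at this
    · have h1 := key q
      rw [hi] at h1
      rcases hj : f j with _ | ⟨r, v⟩
      · rw [hj] at h1
        simp [F, εne] at h1
      · rw [hj] at h1
        simp only [F, Option.elim_some, if_true] at h1
        split_ifs at h1 with hr
        · rw [mul_comm, ← εmul] at h1
          rw [hr, εinj _ _ h1]
          rfl
        · exact absurd h1.symm (mul_ne_zero (εne g) (εne u))
  · intro U
    -- Signs act freely on nonzero functions, so the coordinate functions on U have a kernel in
    -- Q_n(G).
    let B : PointedAction (U → ℂ) G :=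
      { act := fun t g x => ε g * t x
        zero := 0
        act_one := fun t => funext fun x => by rw [ε1, one_mul]
        act_act := fun t g h => funext fun x => by rw [εmul]; ring
        zero_act := fun g => funext fun x => mul_zero _
        free := fun t g h => by
          rcases huniv g with rfl | rfl
          · exact Or.inr rfl
          · left
            funext x
            have := congrFun h x
            rw [ε0, neg_one_mul, neg_eq_self] at this
            exact this }
    obtain ⟨P, hP⟩ := B.exists_ker (n := n) (f := fun i x => ξ i x.1) (funext fun x => ξ0 _)
    refine ⟨P, fun i j g => (hP i j g).trans ⟨fun h x hx => ?_, fun h => funext fun x => ?_⟩⟩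
    · rw [hmem]
      exact congrFun h ⟨x, hx⟩
    · exact (hmem i j g x.1).1 (h x.2)

end DowlingGeometry

theorem mainTheorem7 (n : ℕ) (hn : 2 ≤ n) (G : Type*) [Group G] [Finite G] :
    RealRooted (hPolynomial (orderComplex (DowlingGeometry n G))) ∧
    RealRooted (hPolynomial (orderComplex
      (Set.Ioo (⊥ : DowlingGeometry n G) (⊤ : DowlingGeometry n G)))) ∧
    RealRooted (chowPolynomial (DowlingGeometry n G)) ∧
    RealRooted (augmentedChowPolynomial (DowlingGeometry n G)) ∧
    (Nat.card G = 1 →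
      Nonempty (DowlingGeometry n G ≃o IntersectionLattice (braidArrangementA (n + 1)))) ∧
    (Nat.card G = 2 →
      Nonempty (DowlingGeometry n G ≃o IntersectionLattice (braidArrangementB n))) :=
  have hn0 : n ≠ 0 := by omega
  ⟨DowlingGeometry.realRooted_hPolynomial hn0, DowlingGeometry.realRooted_hPolynomial_properPart hn0,
    DowlingGeometry.realRooted_chowPolynomial hn0,
    DowlingGeometry.realRooted_augmentedChowPolynomial,
    DowlingGeometry.nonempty_orderIso_braidArrangementA,
    DowlingGeometry.nonempty_orderIso_braidArrangementB⟩
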